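/- Let $\mathbb{B}^m=\{z\in\mathbb{C}^m : |z_1|^2+\cdots+|z_m|^2<1\}$, let $L^2_a(\mathbb{B}^m)$ be the Bergman space of holomorphic functions on $\mathbb{B}^m$ that are square integrable for the normalized Lebesgue measure, and let $A=\mathbb{C}[z_1,\dots,z_m]$ act on it by multiplication. For $\mathfrak{n}\in\mathbb{N}^m$ let $e_{\mathfrak{n}}=z_1^{n_1}\cdots z_m^{n_m}/\sqrt{\omega_0(\mathfrak{n})}$, with $\omega_0(\mathfrak{n})=\frac{n_1!\cdots n_m!\,m!}{(n_1+\cdots+n_m+m)!}$, be the normalized monomials. A box is a set $\mathcal{B}^{\mathfrak{b}}_{\mathfrak{j}}=\{\mathfrak{n}\in\mathbb{N}^m : n_i\le b_i \text{ for all } i\in\mathfrak{j}\}$, where $\mathfrak{j}\subseteq\{1,\dots,m\}$ (possibly empty) and $\mathfrak{b}=(b_i)_{i\in\mathfrak{j}}\in\mathbb{N}^{\mathfrak{j}}$; an intersection of finitely many boxes is a box. The box module $\mathcal{H}^{\mathfrak{b}}_{\mathfrak{j}}$ is the closed subspace of those $f\in L^2_a(\mathbb{B}^m)$ with $\langle f,e_{\mathfrak{n}}\rangle=0$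 for all $\mathfrak{n}\notin\mathcal{B}^{\mathfrak{b}}_{\mathfrak{j}}$. A polynomial $p\in A$ acts on it by $f\mapsto P(pf)$, where $P$ is the orthogonal projection of $L^2_a(\mathbb{B}^m)$ onto $\mathcal{H}^{\mathfrak{b}}_{\mathfrak{j}}$; that is, $z_i$ sends a monomial of the box to its product with $z_i$ if this is again in the box, and to $0$ otherwise. **Theorem.** Let $I$ be an ideal of $A$ generated by monomials, and let $\overline{I}$ be its closure in $L^2_a(\mathbb{B}^m)$. There are $k\ge 0$ and boxes $\mathcal{B}_1,\dots,\mathcal{B}_k\subseteq\mathbb{N}^m$ such that, if $\mathcal{A}_q$ (for $1\le q\le k$) denotes the Hilbert $A$-module that is the orthogonal direct sum, over all $S\subseteq\{1,\dots,k\}$ with $|S|=q$, of the box modules of the boxes $\bigcap_{s\in S}\mathcal{B}_s$, and $\mathcal{A}_0=L^2_a(\mathbb{B}^m)$, then there are bounded $A$-module maps $\Psi_i:\mathcal{A}_i\to\mathcal{A}_{i+1}$, $0\le i\le k-1$, for which $$0\longrightarrow \overline{I}\hookrightarrow L^2_a(\mathbb{B}^m)\stackrel{\Psi_0}{\longrightarrow}\mathcal{A}_1\stackrel{\Psi_1}{\longrightarrow}\cdots\stackrel{\Psi_{k-1}}{\longrightarrow}\mathcal{A}_k\longrightarrow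 0$$ is exact. (For $k=0$, which occurs for $I=A$, this says $\overline{I}=L^2_a(\mathbb{B}^m)$.) -/

import Mathlib

open MeasureTheory Filter Topology
open scoped ENNReal InnerProductSpace

noncomputable section

namespace BergmanBox

/-! ### The unit ball and its normalized Lebesgue measure -/

/-- The open Euclidean unit ball of `ℂ^m`. -/
def unitBall (m : ℕ) : Set (Fin m → ℂ) := {z | ∑ i, ‖z i‖ ^ 2 < 1}

/-- Lebesgue measure on the unit ball, normalized to total mass one. -/
def ballMeasure (m : ℕ) : Measure (Fin m → ℂ) :=
  ProbabilityTheory.cond (volume : Measure (Fin m → ℂ)) (unitBall m)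

theorem isOpen_unitBall (m : ℕ) : IsOpen (unitBall m) :=
  isOpen_lt (by fun_prop) continuous_const

theorem unitBall_subset (m : ℕ) : unitBall m ⊆ Metric.closedBall 0 1 := by
  intro z hz
  have hz' : ∑ i, ‖z i‖ ^ 2 < 1 := hz
  rw [mem_closedBall_zero_iff, pi_norm_le_iff_of_nonneg zero_le_one]
  intro i
  have h1 : ‖z i‖ ^ 2 ≤ ∑ i, ‖z i‖ ^ 2 :=
    Finset.single_le_sum (f := fun i => ‖z i‖ ^ 2) (fun j _ => sq_nonneg _) (Finset.mem_univ i)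
  nlinarith [norm_nonneg (z i)]

theorem volume_unitBall_ne_zero (m : ℕ) : volume (unitBall m) ≠ 0 :=
  ((isOpen_unitBall m).measure_pos volume ⟨0, by simp [unitBall]⟩).ne'

theorem volume_unitBall_ne_top (m : ℕ) : volume (unitBall m) ≠ ∞ :=
  ((measure_mono (unitBall_subset m)).trans_lt measure_closedBall_lt_top).ne

instance (m : ℕ) : IsProbabilityMeasure (ballMeasure m) :=
  ProbabilityTheory.cond_isProbabilityMeasure_of_finite
    (volume_unitBall_ne_zero m) (volume_unitBall_ne_top m)

theorem ballMeasure_eq (m : ℕ) :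
    ballMeasure m = (volume (unitBall m))⁻¹ • volume.restrict (unitBall m) := rfl

theorem ae_mem_unitBall (m : ℕ) : ∀ᵐ z ∂(ballMeasure m), z ∈ unitBall m := by
  rw [ballMeasure_eq]
  exact Measure.ae_smul_measure (ae_restrict_mem (isOpen_unitBall m).measurableSet) _

theorem restrict_eq_smul (m : ℕ) :
    (volume : Measure (Fin m → ℂ)).restrict (unitBall m)
      = volume (unitBall m) • ballMeasure m := by
  rw [ballMeasure_eq, smul_smul,
    ENNReal.mul_inv_cancel (volume_unitBall_ne_zero m) (volume_unitBall_ne_top m), one_smul]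

/-! ### The Bergman space -/

/-- The Bergman space `L²_a(𝔹^m)`: the classes in `L²` of the normalized Lebesgue measure
on the ball that have a holomorphic representative. -/
def bergman (m : ℕ) : Submodule ℂ (Lp ℂ 2 (ballMeasure m)) where
  carrier := {f | ∃ g : (Fin m → ℂ) → ℂ, DifferentiableOn ℂ g (unitBall m) ∧
    f =ᵐ[ballMeasure m] g}
  zero_mem' := ⟨0, differentiableOn_const 0, Lp.coeFn_zero _ _ _⟩
  add_mem' := by
    rintro a b ⟨g, hg, hag⟩ ⟨h, hh, hbh⟩
    exact ⟨g + h, hg.add hh, (Lp.coeFn_add a b).trans (hag.add hbh)⟩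
  smul_mem' := by
    rintro c a ⟨g, hg, hag⟩
    exact ⟨c • g, hg.const_smul c, (Lp.coeFn_smul c a).trans (hag.const_smul c)⟩

instance (m : ℕ) : NormedAddCommGroup (bergman m) := (bergman m).normedAddCommGroup

instance (m : ℕ) : InnerProductSpace ℂ (bergman m) := (bergman m).innerProductSpace

theorem bergman_ext {m : ℕ} {f g : bergman m}
    (h : (f : Lp ℂ 2 (ballMeasure m)) =ᵐ[ballMeasure m] (g : Lp ℂ 2 (ballMeasure m))) : f = g :=
  Subtype.ext (Lp.ext h)

/-! ### Completeness of the Bergman space -/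

theorem enorm_le_lintegral_circle {m : ℕ} {g : (Fin m → ℂ) → ℂ} {z w : Fin m → ℂ} {r : ℝ}
    (hg : DifferentiableOn ℂ g (Metric.ball z r)) (hw : w ∈ Metric.ball 0 r) :
    ‖g z‖ₑ * ENNReal.ofReal (2 * Real.pi) ≤
      ∫⁻ t in Set.Ioc 0 (2 * Real.pi), ‖g (z + circleMap 0 1 t • w)‖ₑ := by
  have hmap : ∀ u : ℂ, u ∈ Metric.closedBall (0 : ℂ) |1| → z + u • w ∈ Metric.ball z r := by
    intro u hu
    simp only [abs_one, mem_closedBall_zero_iff] at hu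
    rw [mem_ball_zero_iff] at hw
    rw [mem_ball_iff_norm, add_sub_cancel_left, norm_smul]
    nlinarith [norm_nonneg w]
  have hd : ∀ u ∈ Metric.closedBall (0 : ℂ) |1|,
      DifferentiableAt ℂ (fun u : ℂ => g (z + u • w)) u := by
    intro u hu
    have h1 := (hg.differentiableAt (Metric.isOpen_ball.mem_nhds (hmap u hu)))
    exact h1.comp (f := fun u : ℂ => z + u • w) u (by fun_prop)
  have havg := circleAverage_of_differentiable_on_off_countable (s := ∅) (R := 1) (c := 0)
    (f := fun u : ℂ => g (z + u • w)) Set.countable_empty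
    (fun u hu => (hd u hu).continuousAt.continuousWithinAt)
    (fun u hu => hd u (Metric.ball_subset_closedBall hu.1))
  simp only [zero_smul, add_zero] at havg
  rw [← havg, Real.circleAverage_def, enorm_smul,
    intervalIntegral.integral_of_le (by positivity)]
  have hpi : ‖(2 * Real.pi)⁻¹‖ₑ * ENNReal.ofReal (2 * Real.pi) = 1 := by
    rw [Real.enorm_eq_ofReal (by positivity), ← ENNReal.ofReal_mul (by positivity),
      inv_mul_cancel₀ (by positivity), ENNReal.ofReal_one]
  calc _ = (‖(2 * Real.pi)⁻¹‖ₑ * ENNReal.ofReal (2 * Real.pi)) *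
        ‖∫ t in Set.Ioc 0 (2 * Real.pi), g (z + circleMap 0 1 t • w)‖ₑ := by ring
    _ ≤ _ := by
      rw [hpi, one_mul]
      exact enorm_integral_le_lintegral_enorm _

theorem measurePreserving_smul {m : ℕ} (c : ℂ) (hc : ‖c‖ = 1) :
    MeasurePreserving (fun w : Fin m → ℂ => c • w) volume volume := by
  obtain ⟨a, rfl⟩ : ∃ a : Circle, (a : ℂ) = c := ⟨⟨c, mem_sphere_zero_iff_norm.2 hc⟩, rfl⟩
  have h : MeasurePreserving (fun u : ℂ => (a : ℂ) * u) volume volume :=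
    (rotation a).measurePreserving
  exact volume_preserving_pi (fun _ : Fin m => h)

theorem mean_value_le {m : ℕ} {g : (Fin m → ℂ) → ℂ} {z : Fin m → ℂ} {r : ℝ}
    (hg : DifferentiableOn ℂ g (Metric.ball z r)) :
    ‖g z‖ₑ * volume (Metric.ball (0 : Fin m → ℂ) r) ≤ ∫⁻ w in Metric.ball z r, ‖g w‖ₑ := by
  set G : (Fin m → ℂ) → ℝ≥0∞ := (Metric.ball z r).indicator (fun w => ‖g w‖ₑ) with hG
  have hGm : Measurable G := by
    have h0 : ContinuousOn (fun w => ‖g w‖ₑ) (Metric.ball z r) := hg.continuousOn.enorm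
    classical
    have h1 : G = (Metric.ball z r).piecewise (fun w => ‖g w‖ₑ) 0 := by
      rw [hG, Set.piecewise_eq_indicator]
    rw [h1]
    exact h0.measurable_piecewise continuousOn_const Metric.isOpen_ball.measurableSet
  set c := ENNReal.ofReal (2 * Real.pi) with hcdef
  have hc0 : c ≠ 0 := by simp [hcdef, Real.pi_pos]
  have hcT : c ≠ ∞ := ENNReal.ofReal_ne_top
  have hpt : ∀ w ∈ Metric.ball (0 : Fin m → ℂ) r, ‖g z‖ₑ * c ≤
      ∫⁻ t in Set.Ioc 0 (2 * Real.pi), G (z + circleMap 0 1 t • w) := by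
    intro w hw
    refine (enorm_le_lintegral_circle hg hw).trans (le_of_eq ?_)
    refine lintegral_congr fun t => ?_
    rw [hG, Set.indicator_of_mem]
    rw [mem_ball_iff_norm, add_sub_cancel_left, norm_smul]
    simpa using hw
  have hinner : ∀ t : ℝ, ∫⁻ w : Fin m → ℂ, G (z + circleMap 0 1 t • w)
      = ∫⁻ w in Metric.ball z r, ‖g w‖ₑ := by
    intro t
    have h1 := (measurePreserving_smul (m := m) (circleMap 0 1 t) (by simp)).lintegral_comp
      (f := fun w => G (z + w)) (hGm.comp (measurable_const_add z))
    rw [h1, lintegral_add_left_eq_self G z, hG,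
      lintegral_indicator Metric.isOpen_ball.measurableSet]
  have key : c * (‖g z‖ₑ * volume (Metric.ball (0 : Fin m → ℂ) r))
      ≤ c * ∫⁻ w in Metric.ball z r, ‖g w‖ₑ := by
    calc c * (‖g z‖ₑ * volume (Metric.ball (0 : Fin m → ℂ) r))
        = ∫⁻ _ in Metric.ball (0 : Fin m → ℂ) r, ‖g z‖ₑ * c := by
          rw [setLIntegral_const]; ring
      _ ≤ ∫⁻ w in Metric.ball (0 : Fin m → ℂ) r,
            ∫⁻ t in Set.Ioc 0 (2 * Real.pi), G (z + circleMap 0 1 t • w) :=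
          setLIntegral_mono' Metric.isOpen_ball.measurableSet hpt
      _ ≤ ∫⁻ w, ∫⁻ t in Set.Ioc 0 (2 * Real.pi), G (z + circleMap 0 1 t • w) :=
          setLIntegral_le_lintegral _ _
      _ = ∫⁻ t in Set.Ioc 0 (2 * Real.pi), ∫⁻ w : Fin m → ℂ, G (z + circleMap 0 1 t • w) := by
          refine lintegral_lintegral_swap (Measurable.aemeasurable ?_)
          refine hGm.comp ?_
          have : Continuous fun p : (Fin m → ℂ) × ℝ => z + circleMap 0 1 p.2 • p.1 := by
            have := continuous_circleMap 0 1
            fun_prop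
          exact this.measurable
      _ = _ := by
          simp_rw [hinner]
          rw [setLIntegral_const, Real.volume_Ioc, sub_zero, mul_comm]
  exact (ENNReal.mul_le_mul_iff_right hc0 hcT).1 key

/-- Point evaluations are bounded by the `L²` norm, uniformly away from the sphere. -/
theorem exists_eval_bound (m : ℕ) {r : ℝ} (hr : 0 < r) :
    ∃ C : ℝ≥0∞, C ≠ ∞ ∧ ∀ (g : (Fin m → ℂ) → ℂ) (z : Fin m → ℂ),
      DifferentiableOn ℂ g (unitBall m) → Metric.ball z r ⊆ unitBall m →
      ‖g z‖ₑ ≤ C * eLpNorm g 2 (ballMeasure m) := by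
  set V := volume (Metric.ball (0 : Fin m → ℂ) r) with hV
  have hV0 : V ≠ 0 := (Metric.measure_ball_pos volume _ hr).ne'
  have hVT : V ≠ ∞ := measure_ball_lt_top.ne
  refine ⟨V⁻¹ * volume (unitBall m),
    ENNReal.mul_ne_top (ENNReal.inv_ne_top.2 hV0) (volume_unitBall_ne_top m), ?_⟩
  intro g z hg hz
  have hgm : AEStronglyMeasurable g (ballMeasure m) := by
    rw [ballMeasure_eq]
    exact (hg.continuousOn.aestronglyMeasurable
      (isOpen_unitBall m).measurableSet).smul_measure _
  have h1 := mean_value_le (hg.mono hz)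
  have h2 : ∫⁻ w in Metric.ball z r, ‖g w‖ₑ
      ≤ volume (unitBall m) * eLpNorm g 2 (ballMeasure m) := by
    calc ∫⁻ w in Metric.ball z r, ‖g w‖ₑ ≤ ∫⁻ w in unitBall m, ‖g w‖ₑ :=
          lintegral_mono_set hz
      _ = volume (unitBall m) * ∫⁻ w, ‖g w‖ₑ ∂(ballMeasure m) := by
          rw [restrict_eq_smul, lintegral_smul_measure, smul_eq_mul]
      _ = volume (unitBall m) * eLpNorm g 1 (ballMeasure m) := by
          rw [eLpNorm_one_eq_lintegral_enorm]
      _ ≤ _ := by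
          gcongr
          exact eLpNorm_le_eLpNorm_of_exponent_le (by norm_num) hgm
  have h3 : ‖g z‖ₑ = V⁻¹ * (‖g z‖ₑ * V) := by
    rw [mul_comm, mul_assoc, ENNReal.mul_inv_cancel hV0 hVT, mul_one]
  rw [h3, mul_assoc]
  exact mul_le_mul_right (h1.trans h2) _

/-- A sequence of holomorphic functions which is Cauchy in `L²` of the ball has a locally uniform
holomorphic limit. -/
theorem exists_holomorphic_limit {m : ℕ} {g : ℕ → (Fin m → ℂ) → ℂ}
    (hg : ∀ k, DifferentiableOn ℂ (g k) (unitBall m))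
    (hc : ∀ ε : ℝ≥0∞, ε ≠ 0 → ∃ N, ∀ k ≥ N, ∀ l ≥ N,
      eLpNorm (g k - g l) 2 (ballMeasure m) < ε) :
    ∃ G : (Fin m → ℂ) → ℂ, DifferentiableOn ℂ G (unitBall m) ∧
      ∀ z ∈ unitBall m, Tendsto (fun k => g k z) atTop (𝓝 (G z)) := by
  -- uniform smallness near every point of the ball
  have hunif : ∀ r : ℝ, 0 < r → ∀ ε : ℝ, 0 < ε → ∃ N, ∀ k ≥ N, ∀ l ≥ N,
      ∀ z, Metric.ball z r ⊆ unitBall m → ‖g k z - g l z‖ ≤ ε := by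
    intro r hr ε hε
    obtain ⟨C, hC, hb⟩ := exists_eval_bound m hr
    obtain ⟨N, hN⟩ := hc (ENNReal.ofReal ε / (C + 1)) (by
      simp [ENNReal.div_eq_zero_iff, hε, hC])
    refine ⟨N, fun k hk l hl z hz => ?_⟩
    have h1 := hb (g k - g l) z ((hg k).sub (hg l)) hz
    have h2 : ‖g k z - g l z‖ₑ ≤ ENNReal.ofReal ε := by
      calc _ ≤ C * eLpNorm (g k - g l) 2 (ballMeasure m) := h1
        _ ≤ (C + 1) * (ENNReal.ofReal ε / (C + 1)) := by
            gcongr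
            · exact le_self_add
            · exact (hN k hk l hl).le
        _ ≤ ENNReal.ofReal ε := ENNReal.mul_div_le
    rw [← ofReal_norm] at h2
    exact (ENNReal.ofReal_le_ofReal_iff hε.le).1 h2
  have hopen : ∀ z ∈ unitBall m, ∃ r : ℝ, 0 < r ∧ Metric.ball z (3 * r) ⊆ unitBall m := by
    intro z hz
    obtain ⟨s, hs, hsub⟩ := Metric.isOpen_iff.1 (isOpen_unitBall m) z hz
    exact ⟨s / 3, by positivity, by rwa [mul_div_cancel₀ _ (by norm_num : (3 : ℝ) ≠ 0)]⟩
  have hlim : ∀ z ∈ unitBall m, ∃ y, Tendsto (fun k => g k z) atTop (𝓝 y) := by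
    intro z hz
    obtain ⟨r, hr, hsub⟩ := hopen z hz
    refine cauchySeq_tendsto_of_complete (Metric.cauchySeq_iff.2 fun ε hε => ?_)
    obtain ⟨N, hN⟩ := hunif (3 * r) (by positivity) (ε / 2) (by positivity)
    exact ⟨N, fun k hk l hl => by
      rw [dist_eq_norm]
      exact (hN k hk l hl z hsub).trans_lt (by linarith)⟩
  have hderiv : ∀ z ∈ unitBall m, ∀ r : ℝ, 0 < r → Metric.ball z (3 * r) ⊆ unitBall m →
      ∀ ε : ℝ, 0 < ε → ∃ N, ∀ k ≥ N, ∀ l ≥ N, ∀ y ∈ Metric.ball z r,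
        ‖fderiv ℂ (g k) y - fderiv ℂ (g l) y‖ ≤ ε := by
    intro z hz r hr hsub ε hε
    obtain ⟨N, hN⟩ := hunif r hr (ε * r / 2) (by positivity)
    refine ⟨N, fun k hk l hl y hy => ?_⟩
    have hyr : Metric.ball y r ⊆ unitBall m := by
      refine (Metric.ball_subset_ball' ?_).trans hsub
      rw [Metric.mem_ball] at hy; linarith
    have hy2 : ∀ x ∈ Metric.ball y r, Metric.ball x r ⊆ unitBall m := by
      intro x hx
      refine (Metric.ball_subset_ball' ?_).trans hsub
      rw [Metric.mem_ball] at hy hx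
      linarith [dist_triangle x y z]
    have hyU : y ∈ unitBall m := hyr (Metric.mem_ball_self hr)
    have hda : ∀ j, DifferentiableAt ℂ (g j) y := fun j =>
      (hg j).differentiableAt ((isOpen_unitBall m).mem_nhds hyU)
    rw [← fderiv_sub (hda k) (hda l)]
    have := Complex.norm_fderiv_le_div_of_mapsTo_ball (f := g k - g l) (c := y) (R₁ := r)
      (R₂ := ε * r) (((hg k).sub (hg l)).mono hyr) (fun x hx => by
        rw [mem_closedBall_iff_norm]
        have h1 := hN k hk l hl x (hy2 x hx)
        have h2 := hN k hk l hl y hyr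
        calc _ ≤ ‖g k x - g l x‖ + ‖g k y - g l y‖ := norm_sub_le _ _
          _ ≤ ε * r := by linarith) hr
    rwa [mul_div_cancel_right₀ _ hr.ne'] at this
  have hlim' : ∀ z ∈ unitBall m, ∃ y, Tendsto (fun k => fderiv ℂ (g k) z) atTop (𝓝 y) := by
    intro z hz
    obtain ⟨r, hr, hsub⟩ := hopen z hz
    refine cauchySeq_tendsto_of_complete (Metric.cauchySeq_iff.2 fun ε hε => ?_)
    obtain ⟨N, hN⟩ := hderiv z hz r hr hsub (ε / 2) (by positivity)
    exact ⟨N, fun k hk l hl => by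
      rw [dist_eq_norm]
      exact (hN k hk l hl z (Metric.mem_ball_self hr)).trans_lt (by linarith)⟩
  choose! G hG using hlim
  choose! G' hG' using hlim'
  refine ⟨G, fun z hz => ?_, hG⟩
  have hloc : TendstoLocallyUniformlyOn (fun k => fderiv ℂ (g k)) G' atTop (unitBall m) := by
    rw [Metric.tendstoLocallyUniformlyOn_iff]
    intro ε hε z hz
    obtain ⟨r, hr, hsub⟩ := hopen z hz
    obtain ⟨N, hN⟩ := hderiv z hz r hr hsub (ε / 2) (by positivity)
    refine ⟨Metric.ball z r, mem_nhdsWithin_of_mem_nhds (Metric.ball_mem_nhds z hr), ?_⟩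
    filter_upwards [eventually_ge_atTop N] with k hk y hy
    have hyU : y ∈ unitBall m := hsub (Metric.ball_subset_ball (by linarith) hy)
    have : ‖G' y - fderiv ℂ (g k) y‖ ≤ ε / 2 := by
      refine le_of_tendsto ((hG' y hyU).sub_const _).norm ?_
      filter_upwards [eventually_ge_atTop N] with l hl
      exact hN l hl k hk y hy
    rw [dist_eq_norm]
    linarith
  exact (hasFDerivAt_of_tendstoLocallyUniformlyOn (isOpen_unitBall m) hloc
    (fun k x hx => ((hg k).differentiableAt
      ((isOpen_unitBall m).mem_nhds hx)).hasFDerivAt) hG hz).differentiableAt.differentiableWithinAt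

theorem isClosed_bergman (m : ℕ) : IsClosed (bergman m : Set (Lp ℂ 2 (ballMeasure m))) := by
  refine isClosed_of_closure_subset fun F hF => ?_
  obtain ⟨f, hf, hfF⟩ := mem_closure_iff_seq_limit.1 hF
  choose g hg hfg using hf
  have hcauchy : ∀ ε : ℝ≥0∞, ε ≠ 0 → ∃ N, ∀ k ≥ N, ∀ l ≥ N,
      eLpNorm (g k - g l) 2 (ballMeasure m) < ε := by
    intro ε hε
    obtain ⟨N, hN⟩ := EMetric.cauchySeq_iff.1 hfF.cauchySeq ε (pos_iff_ne_zero.2 hε)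
    refine ⟨N, fun k hk l hl => ?_⟩
    have := hN k hk l hl
    rwa [Lp.edist_def, eLpNorm_congr_ae ((hfg k).sub (hfg l))] at this
  obtain ⟨G, hGd, hG⟩ := exists_holomorphic_limit hg hcauchy
  refine ⟨G, hGd, ?_⟩
  obtain ⟨ns, hns, hae⟩ := (tendstoInMeasure_of_tendsto_Lp hfF).exists_seq_tendsto_ae
  filter_upwards [hae, ae_mem_unitBall m, ae_all_iff.2 hfg] with z hz hzU hzfg
  refine tendsto_nhds_unique hz ?_
  have : (fun i => f (ns i) z) = fun i => g (ns i) z := funext fun i => hzfg (ns i)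
  rw [this]
  exact (hG z hzU).comp hns.tendsto_atTop

instance (m : ℕ) : CompleteSpace (bergman m) := (isClosed_bergman m).completeSpace_coe

/-! ### The module structure of the Bergman space over the polynomial algebra -/

theorem exists_poly_bound {m : ℕ} (p : MvPolynomial (Fin m) ℂ) :
    ∃ C : ℝ, 0 ≤ C ∧ ∀ z ∈ unitBall m, ‖MvPolynomial.eval z p‖ ≤ C := by
  obtain ⟨C, hC⟩ := (isCompact_closedBall (0 : Fin m → ℂ) 1).exists_bound_of_continuousOn
    (f := fun z => MvPolynomial.eval z p) (MvPolynomial.continuous_eval p).continuousOn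
  exact ⟨max C 0, le_max_right _ _, fun z hz =>
    (hC z (unitBall_subset m hz)).trans (le_max_left _ _)⟩

theorem memLp_poly_mul {m : ℕ} (p : MvPolynomial (Fin m) ℂ) (f : Lp ℂ 2 (ballMeasure m)) :
    MemLp (fun z => MvPolynomial.eval z p * f z) 2 (ballMeasure m) := by
  obtain ⟨C, -, hC⟩ := exists_poly_bound p
  refine (Lp.memLp f).of_le_mul (c := C)
    ((MvPolynomial.continuous_eval p).aestronglyMeasurable.mul (Lp.aestronglyMeasurable f)) ?_
  filter_upwards [ae_mem_unitBall m] with z hz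
  rw [norm_mul]
  exact mul_le_mul_of_nonneg_right (hC z hz) (norm_nonneg _)

/-- Polynomials act on the Bergman space by multiplication of functions. -/
instance (m : ℕ) : SMul (MvPolynomial (Fin m) ℂ) (bergman m) where
  smul p f := ⟨(memLp_poly_mul p f).toLp _, by
    obtain ⟨g, hg, hfg⟩ := f.2
    refine ⟨fun z => MvPolynomial.eval z p * g z, DifferentiableOn.mul ?_ hg, ?_⟩
    · exact (AnalyticOnNhd.eval_mvPolynomial p).differentiableOn.mono (Set.subset_univ _)
    · filter_upwards [(memLp_poly_mul p f).coeFn_toLp, hfg] with z h1 h2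
      rw [h1, h2]⟩

theorem coeFn_poly_smul {m : ℕ} (p : MvPolynomial (Fin m) ℂ) (f : bergman m) :
    ((p • f : bergman m) : Lp ℂ 2 (ballMeasure m)) =ᵐ[ballMeasure m]
      fun z => MvPolynomial.eval z p * (f : Lp ℂ 2 (ballMeasure m)) z :=
  (memLp_poly_mul p f).coeFn_toLp

theorem coeFn_bergman_add {m : ℕ} (f g : bergman m) :
    ((f + g : bergman m) : Lp ℂ 2 (ballMeasure m)) =ᵐ[ballMeasure m]
      fun z => (f : Lp ℂ 2 (ballMeasure m)) z + (g : Lp ℂ 2 (ballMeasure m)) z :=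
  Lp.coeFn_add _ _

theorem coeFn_bergman_smul {m : ℕ} (c : ℂ) (f : bergman m) :
    ((c • f : bergman m) : Lp ℂ 2 (ballMeasure m)) =ᵐ[ballMeasure m]
      fun z => c * (f : Lp ℂ 2 (ballMeasure m)) z :=
  Lp.coeFn_smul _ _

instance (m : ℕ) : Module (MvPolynomial (Fin m) ℂ) (bergman m) :=
  Module.ofMinimalAxioms
    (fun p f g => bergman_ext (by
      filter_upwards [coeFn_poly_smul p (f + g), coeFn_bergman_add f g, coeFn_poly_smul p f,
        coeFn_poly_smul p g, coeFn_bergman_add (p • f) (p • g)] with z h1 h2 h3 h4 h5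
      rw [h1, h2, h5, h3, h4]; ring))
    (fun p q f => bergman_ext (by
      filter_upwards [coeFn_poly_smul (p + q) f, coeFn_poly_smul p f,
        coeFn_poly_smul q f, coeFn_bergman_add (p • f) (q • f)] with z h1 h2 h3 h4
      rw [h1, h4, h2, h3, map_add]; ring))
    (fun p q f => bergman_ext (by
      filter_upwards [coeFn_poly_smul (p * q) f, coeFn_poly_smul p (q • f),
        coeFn_poly_smul q f] with z h1 h2 h3
      rw [h1, h2, h3, map_mul]; ring))
    (fun f => bergman_ext (by
      filter_upwards [coeFn_poly_smul 1 f] with z h1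
      rw [h1, map_one, one_mul]))

instance (m : ℕ) : IsScalarTower ℂ (MvPolynomial (Fin m) ℂ) (bergman m) where
  smul_assoc c p f := bergman_ext (by
    filter_upwards [coeFn_poly_smul (c • p) f, coeFn_poly_smul p f,
      coeFn_bergman_smul c (p • f)] with z h1 h2 h3
    rw [h1, h3, h2, MvPolynomial.smul_eval]; ring)

theorem norm_poly_smul_le {m : ℕ} (p : MvPolynomial (Fin m) ℂ) :
    ∃ C : ℝ, 0 ≤ C ∧ ∀ f : bergman m, ‖p • f‖ ≤ C * ‖f‖ := by
  obtain ⟨C, hC0, hC⟩ := exists_poly_bound p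
  refine ⟨C, hC0, fun f => ?_⟩
  refine Lp.norm_le_mul_norm_of_ae_le_mul ?_
  filter_upwards [coeFn_poly_smul p f, ae_mem_unitBall m] with z h1 hz
  change ‖((p • f : bergman m) : Lp ℂ 2 (ballMeasure m)) z‖
    ≤ C * ‖(f : Lp ℂ 2 (ballMeasure m)) z‖
  rw [h1, norm_mul]
  exact mul_le_mul_of_nonneg_right (hC z hz) (norm_nonneg _)

instance (m : ℕ) : ContinuousConstSMul (MvPolynomial (Fin m) ℂ) (bergman m) where
  continuous_const_smul p := by
    obtain ⟨C, -, hC⟩ := norm_poly_smul_le (m := m) p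
    exact AddMonoidHomClass.continuous_of_bound
      (DistribSMul.toAddMonoidHom (bergman m) p) C hC

/-! ### Polynomials, monomials and closures of ideals -/

/-- The constant function `1`. -/
def one (m : ℕ) : bergman m :=
  ⟨(memLp_const (1 : ℂ)).toLp (fun _ => 1), fun _ => 1, differentiableOn_const 1,
    MemLp.coeFn_toLp _⟩

/-- The inclusion `ℂ[z₁,…,z_m] → L²_a(𝔹^m)` of `A`-modules, which sends `p` to the class of the
function `z ↦ p(z)`. -/
def polyIncl (m : ℕ) : MvPolynomial (Fin m) ℂ →ₗ[MvPolynomial (Fin m) ℂ] bergman m :=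
  LinearMap.toSpanSingleton _ _ (one m)

theorem coeFn_polyIncl {m : ℕ} (p : MvPolynomial (Fin m) ℂ) :
    (polyIncl m p : Lp ℂ 2 (ballMeasure m)) =ᵐ[ballMeasure m]
      fun z => MvPolynomial.eval z p := by
  have h : (one m : Lp ℂ 2 (ballMeasure m)) =ᵐ[ballMeasure m] fun _ => 1 :=
    (memLp_const (1 : ℂ)).coeFn_toLp
  filter_upwards [coeFn_poly_smul p (one m), h] with z h1 h2
  rw [polyIncl, LinearMap.toSpanSingleton_apply, h1, h2, mul_one]

/-- The closure of an ideal of polynomials in the Bergman space; it is an `A`-submodule. -/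
def idealClosure {m : ℕ} (I : Ideal (MvPolynomial (Fin m) ℂ)) :
    Submodule (MvPolynomial (Fin m) ℂ) (bergman m) :=
  (Submodule.map (polyIncl m) I).topologicalClosure

/-- The squared norm `ω₀(𝔫) = n₁!⋯n_m! m! / (n₁+⋯+n_m+m)!` of the monomial with exponent `𝔫`. -/
def omega {m : ℕ} (n : Fin m →₀ ℕ) : ℝ :=
  ((∏ i, (n i).factorial) * m.factorial : ℝ) / ((∑ i, n i) + m).factorial

/-- The normalized monomial `z₁^{n₁}⋯z_m^{n_m} / √ω₀(𝔫)`. -/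
def basisVec {m : ℕ} (n : Fin m →₀ ℕ) : bergman m :=
  ((Real.sqrt (omega n))⁻¹ : ℂ) • polyIncl m (MvPolynomial.monomial n 1)

/-- The coefficient `f_𝔫` of `f` along the normalized monomial with exponent `𝔫`. -/
def coeff {m : ℕ} (n : Fin m →₀ ℕ) (f : bergman m) : ℂ := ⟪basisVec n, f⟫_ℂ

/-! ### Boxes and their Hilbert modules -/

/-- The box with bounds `β : Fin m → ℕ∞`. A pair `(𝔧, 𝔟)` is encoded by the function `β` that is
equal to `b^k` at `j^k` and to `∞` off `𝔧`; conversely `𝔧 = {i | β i < ∞}`. -/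
def box {m : ℕ} (β : Fin m → ℕ∞) : Set (Fin m →₀ ℕ) := {n | ∀ i, (n i : ℕ∞) ≤ β i}

/-- The intersection of two boxes is the box of the pointwise minimum of the bounds. -/
theorem box_inf {m : ℕ} (β γ : Fin m → ℕ∞) : box (β ⊓ γ) = box β ∩ box γ := by
  ext n
  simp [box, forall_and]

/-- The Hilbert space `H_𝔧^𝔟`: the elements of the Bergman space all of whose coefficients outside
the box vanish. -/
def boxSpace {m : ℕ} (β : Fin m → ℕ∞) : Submodule ℂ (bergman m) where
  carrier := {f | ∀ n, n ∉ box β → coeff n f = 0}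
  zero_mem' := fun n _ => inner_zero_right _
  add_mem' := by
    intro a b ha hb n hn
    have h1 := ha n hn
    have h2 := hb n hn
    unfold coeff at *
    rw [inner_add_right, h1, h2, add_zero]
  smul_mem' := by
    intro c a ha n hn
    have h1 := ha n hn
    unfold coeff at *
    rw [inner_smul_right, h1, mul_zero]

instance {m : ℕ} (β : Fin m → ℕ∞) : NormedAddCommGroup (boxSpace β) :=
  (boxSpace β).normedAddCommGroup

instance {m : ℕ} (β : Fin m → ℕ∞) : InnerProductSpace ℂ (boxSpace β) :=
  (boxSpace β).innerProductSpace

theorem isClosed_boxSpace {m : ℕ} (β : Fin m → ℕ∞) :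
    IsClosed (boxSpace β : Set (bergman m)) := by
  have : (boxSpace β : Set (bergman m)) =
      ⋂ n, ⋂ (_ : n ∉ box β), {f : bergman m | coeff n f = 0} := by
    ext f
    simp only [Set.mem_iInter]
    rfl
  rw [this]
  refine isClosed_iInter fun n => isClosed_iInter fun _ => ?_
  exact isClosed_eq (f := coeff n) (innerSL ℂ (basisVec n)).continuous continuous_const

instance {m : ℕ} (β : Fin m → ℕ∞) : CompleteSpace (boxSpace β) :=
  (isClosed_boxSpace β).completeSpace_coe

/-- The orthogonal projection of the Bergman space onto `H_𝔧^𝔟`. -/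
def boxProj {m : ℕ} (β : Fin m → ℕ∞) : bergman m →L[ℂ] boxSpace β :=
  (boxSpace β).orthogonalProjectionOnto

/-- A polynomial `p` acts on `H_𝔧^𝔟` as the compression to `H_𝔧^𝔟` of multiplication by `p`. In
particular `z_i` sends the monomial `z^𝔫` of the box to `z_i z^𝔫` if this is again a
monomial of the box, and to `0` otherwise. -/
instance {m : ℕ} (β : Fin m → ℕ∞) : SMul (MvPolynomial (Fin m) ℂ) (boxSpace β) where
  smul p f := boxProj β (p • (f : bergman m))

theorem boxSpace_smul_def {m : ℕ} (β : Fin m → ℕ∞) (p : MvPolynomial (Fin m) ℂ)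
    (f : boxSpace β) : p • f = boxProj β (p • (f : bergman m)) := rfl

/-- The orthogonal complement of `H_𝔧^𝔟`, the closed span of the monomials outside the box, is
invariant under multiplication by polynomials. -/
theorem poly_smul_mem_orthogonal {m : ℕ} (β : Fin m → ℕ∞) (p : MvPolynomial (Fin m) ℂ)
    {f : bergman m} (hf : f ∈ (boxSpace β)ᗮ) : p • f ∈ (boxSpace β)ᗮ := by
  set K : Submodule ℂ (bergman m) := Submodule.span ℂ (basisVec '' (box β)ᶜ) with hK
  have hKperp : Kᗮ = boxSpace β := by
    ext f
    rw [Submodule.mem_orthogonal]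
    constructor
    · intro h n hn
      exact h _ (Submodule.subset_span ⟨n, hn, rfl⟩)
    · intro h u hu
      induction hu using Submodule.span_induction with
      | mem x hx => obtain ⟨n, hn, rfl⟩ := hx; exact h n hn
      | zero => exact inner_zero_left _
      | add x y _ _ hx hy => rw [inner_add_left, hx, hy, add_zero]
      | smul c x _ hx => rw [inner_smul_left, hx, mul_zero]
  rw [← hKperp, Submodule.orthogonal_orthogonal_eq_closure] at hf ⊢
  -- multiplication by `p` maps the span into itself
  have hmono : ∀ n, n ∉ box β → polyIncl m (MvPolynomial.monomial n 1) ∈ K := by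
    intro n hn
    have hb : basisVec n ∈ K := Submodule.subset_span ⟨n, hn, rfl⟩
    have hω : ((Real.sqrt (omega n) : ℝ) : ℂ) ≠ 0 := by
      have : 0 < omega n := by unfold omega; positivity
      exact_mod_cast (Real.sqrt_pos.2 this).ne'
    have := K.smul_mem ((Real.sqrt (omega n) : ℝ) : ℂ) hb
    rwa [basisVec, smul_smul, mul_inv_cancel₀ hω, one_smul] at this
  have hsmulC : ∀ (c : ℂ) (q : MvPolynomial (Fin m) ℂ) (x : bergman m),
      q • c • x = c • q • x := fun c q x => bergman_ext (by
    filter_upwards [coeFn_poly_smul q (c • x), coeFn_bergman_smul c x, coeFn_poly_smul q x,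
      coeFn_bergman_smul c (q • x)] with z h1 h2 h3 h4
    rw [h1, h4, h2, h3]; ring)
  have hbasis : ∀ n, n ∉ box β → p • polyIncl m (MvPolynomial.monomial n 1) ∈ K := by
    intro n hn
    induction p using MvPolynomial.induction_on' with
    | monomial u a =>
      rw [← map_smul, smul_eq_mul, MvPolynomial.monomial_mul, mul_one]
      have : MvPolynomial.monomial (u + n) a
          = a • MvPolynomial.monomial (u + n) (1 : ℂ) := by
        rw [MvPolynomial.smul_monomial, smul_eq_mul, mul_one]
      rw [this, LinearMap.map_smul_of_tower]
      refine K.smul_mem _ (hmono _ fun h => hn fun i => le_trans ?_ (h i))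
      exact_mod_cast (by simp : n i ≤ (u + n) i)
    | add p q hp hq => rw [add_smul]; exact K.add_mem hp hq
  have hmap : ∀ x ∈ K, p • x ∈ K := by
    intro x hx
    induction hx using Submodule.span_induction with
    | mem x hx =>
      obtain ⟨n, hn, rfl⟩ := hx
      rw [basisVec, hsmulC]
      exact K.smul_mem _ (hbasis n hn)
    | zero => rw [smul_zero]; exact K.zero_mem
    | add x y _ _ hx hy => rw [smul_add]; exact K.add_mem hx hy
    | smul c x _ hx => rw [hsmulC]; exact K.smul_mem _ hx
  exact map_mem_closure (continuous_const_smul p) hf hmap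

theorem boxProj_smul_boxProj {m : ℕ} (β : Fin m → ℕ∞) (p : MvPolynomial (Fin m) ℂ)
    (f : bergman m) : boxProj β (p • (boxProj β f : bergman m)) = boxProj β (p • f) := by
  have h : f - (boxProj β f : bergman m) ∈ (boxSpace β)ᗮ :=
    Submodule.sub_starProjection_mem_orthogonal f
  have h2 := poly_smul_mem_orthogonal β p h
  have h3 : boxProj β (p • (f - (boxProj β f : bergman m))) = 0 :=
    Submodule.orthogonalProjectionOnto_eq_zero_iff.2 h2
  rw [smul_sub, map_sub, sub_eq_zero] at h3
  exact h3.symm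

theorem boxProj_coe {m : ℕ} (β : Fin m → ℕ∞) (f : boxSpace β) : boxProj β (f : bergman m) = f :=
  Submodule.orthogonalProjectionOnto_mem_subspace_eq_self f

instance {m : ℕ} (β : Fin m → ℕ∞) : Module (MvPolynomial (Fin m) ℂ) (boxSpace β) :=
  Module.ofMinimalAxioms
    (fun p f g => by
      simp only [boxSpace_smul_def, Submodule.coe_add, smul_add, map_add])
    (fun p q f => by simp only [boxSpace_smul_def, add_smul, map_add])
    (fun p q f => by
      simp only [boxSpace_smul_def, boxProj_smul_boxProj, mul_smul])
    (fun f => by simp only [boxSpace_smul_def, one_smul, boxProj_coe])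

instance {m : ℕ} (β : Fin m → ℕ∞) :
    IsScalarTower ℂ (MvPolynomial (Fin m) ℂ) (boxSpace β) where
  smul_assoc c p f := by
    simp only [boxSpace_smul_def, smul_assoc, map_smul]

instance {m : ℕ} (β : Fin m → ℕ∞) :
    ContinuousConstSMul (MvPolynomial (Fin m) ℂ) (boxSpace β) where
  continuous_const_smul p :=
    (boxProj β).continuous.comp ((continuous_const_smul p).comp continuous_subtype_val)

/-- For boxes `B₁, …, B_k` with bounds `β₁, …, β_k`, the Hilbert `A`-module `A_q`: the Hilbert space
direct sum, over all subsets `S` of `{1, …, k}` with `q` elements, of the box modules of the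
intersections `⋂_{s ∈ S} B_s`. -/
abbrev boxSum {m k : ℕ} (β : Fin k → Fin m → ℕ∞) (q : ℕ) : Type :=
  PiLp 2 fun S : {S : Finset (Fin k) // S.card = q} => boxSpace (S.1.inf β)

instance {m k : ℕ} (β : Fin k → Fin m → ℕ∞) (q : ℕ) :
    ContinuousConstSMul (MvPolynomial (Fin m) ℂ) (boxSum β q) where
  continuous_const_smul p := (PiLp.continuous_toLp 2 _).comp <| continuous_pi fun S =>
    (continuous_const_smul p).comp ((continuous_apply S).comp (PiLp.continuous_ofLp 2 _))

/-- The box of the bounds `S.inf β` is the intersection of the boxes. -/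
theorem box_finset_inf {m k : ℕ} (β : Fin k → Fin m → ℕ∞) (S : Finset (Fin k)) :
    box (S.inf β) = ⋂ s ∈ S, box (β s) := by
  ext n
  simp only [box, Set.mem_ofPred_eq, Set.mem_iInter, Finset.inf_apply, Finset.le_inf_iff]
  exact ⟨fun h s hs i => h i s hs, fun h i s hs => h s hs i⟩

/-- Beyond `q = k` there are no subsets with `q` elements, and `A_q = 0`. -/
theorem boxSum_subsingleton {m k : ℕ} (β : Fin k → Fin m → ℕ∞) {q : ℕ} (hq : k < q) :
    Subsingleton (boxSum β q) := by
  have : IsEmpty {S : Finset (Fin k) // S.card = q} := ⟨fun S => by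
    have := S.1.card_le_univ
    rw [S.2, Fintype.card_fin] at this
    omega⟩
  exact ⟨fun x y => by ext S; exact this.elim S⟩

end BergmanBox

end

/-! The exponents of monomials in `I` form an upper set `U` of `ℕ^m`. By Dickson's lemma `U` has
finitely many minimal elements, so its complement is a finite union of boxes `B₁, …, B_k`
(`isBoxUnion_compl_of_isUpperSet`). The maps of the complex are the simplicial coboundaries built
from projections onto smaller boxes.

These projections do not mix monomials, so everything can be checked one exponent `n` at a time. The
components that see `n` are the sets `S` contained in `J = {s | n ∈ B_s}`, and at `n` the complex is
the augmented cochain complex of the full simplex on `J`. If `J` is nonempty, this is contracted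
onto its least vertex (`coboundary_contraction`). If `J` is empty, only `L²_a` contributes. Hence
the complex is exact from `A₁` on, and the kernel of `Ψ₀` consists of the functions whose
coefficients vanish on all the boxes, which is the closure of `I` (`mem_idealClosure_iff`). The
contractions for the various `n` combine into an actual element of the direct sum because there are
only finitely many possible least vertices (`exists_contraction`).

The analytic input is that the monomials are orthogonal and complete in the Bergman space. Averaging
over the torus reduces both facts to Fourier coefficients on orbits, which for a holomorphic
function are multiples of monomials (`exists_orbitCoeff_eq`). The exact norms `ω₀` play no role
beyond being positive. -/

noncomputable section

namespace BergmanBox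

/-! ### The cochain complex of a simplex -/

/-- The sign `(-1)^{#{i ∈ T | i < t}}` of the face of `T` opposite to `t`. -/
def faceSign {k : ℕ} (T : Finset (Fin k)) (t : Fin k) : ℤ := (-1) ^ (T.filter (· < t)).card

/-- The simplicial coboundary. -/
def coboundary {k : ℕ} (y : Finset (Fin k) → ℂ) (T : Finset (Fin k)) : ℂ :=
  ∑ t ∈ T, faceSign T t • y (T.erase t)

theorem faceSign_erase_of_lt {k : ℕ} {T : Finset (Fin k)} {s t : Fin k} (h : s < t) :
    faceSign (T.erase t) s = faceSign T s := by
  unfold faceSign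
  congr 2
  ext i
  simp only [Finset.mem_filter, Finset.mem_erase]
  exact ⟨fun h' => ⟨h'.1.2, h'.2⟩, fun h' => ⟨⟨(h'.2.trans h).ne, h'.1⟩, h'.2⟩⟩

/-- The vertex `t` is one of those counted below `s`, so removing it changes the exponent by one. -/
theorem faceSign_erase_of_gt {k : ℕ} {T : Finset (Fin k)} {s t : Fin k} (ht : t ∈ T)
    (h : t < s) : faceSign (T.erase t) s = -faceSign T s := by
  unfold faceSign
  rw [Finset.filter_erase,
    ← Finset.card_erase_add_one (show t ∈ T.filter (· < s) from Finset.mem_filter.2 ⟨ht, h⟩),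
    pow_succ]
  ring

theorem faceSign_eq_one {k : ℕ} {T : Finset (Fin k)} {t : Fin k} (h : ∀ i ∈ T, t ≤ i) :
    faceSign T t = 1 := by
  unfold faceSign
  rw [Finset.filter_false_of_mem fun i hi => not_lt.2 (h i hi), Finset.card_empty, pow_zero]

/-- Removing two vertices in either order gives the same face with opposite signs, so the double sum
is its own negative. -/
theorem coboundary_coboundary {k : ℕ} (y : Finset (Fin k) → ℂ) (T : Finset (Fin k)) :
    coboundary (coboundary y) T = 0 := by
  -- The diagonal is set to zero so that both indices range over all of `T` and the sums can be
  -- swapped.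
  set F : Fin k → Fin k → ℂ := fun t s =>
    if s = t then 0 else (faceSign T t * faceSign (T.erase t) s) • y ((T.erase t).erase s) with hF
  have h1 : coboundary (coboundary y) T = ∑ t ∈ T, ∑ s ∈ T, F t s := by
    refine Finset.sum_congr rfl fun t ht => ?_
    rw [coboundary, Finset.smul_sum, ← Finset.sum_erase (a := t) T (by simp [hF])]
    refine Finset.sum_congr rfl fun s hs => ?_
    rw [hF]
    simp only [if_neg (Finset.ne_of_mem_erase hs), mul_smul]
  have h2 : ∀ t ∈ T, ∀ s ∈ T, F t s = -F s t := by
    intro t ht s hs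
    rcases lt_trichotomy s t with h | rfl | h
    · simp only [hF, if_neg h.ne, if_neg h.ne', faceSign_erase_of_lt h, faceSign_erase_of_gt hs h,
        Finset.erase_right_comm (a := t) (b := s), ← neg_smul]
      congr 1; ring
    · simp [hF]
    · simp only [hF, if_neg h.ne, if_neg h.ne', faceSign_erase_of_lt h, faceSign_erase_of_gt ht h,
        Finset.erase_right_comm (a := t) (b := s), ← neg_smul]
      congr 1; ring
  have h3 : ∑ t ∈ T, ∑ s ∈ T, F t s = -∑ t ∈ T, ∑ s ∈ T, F t s := by
    conv_lhs => rw [Finset.sum_comm]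
    simp only [← Finset.sum_neg_distrib]
    exact Finset.sum_congr rfl fun s hs => Finset.sum_congr rfl fun t ht => h2 t ht s hs
  rw [h1]
  exact self_eq_neg.1 h3

/-- The contraction of the cochain complex of a simplex onto its smallest vertex. -/
theorem coboundary_contraction {k : ℕ} {y : Finset (Fin k) → ℂ} {j : Fin k}
    {T : Finset (Fin k)} (hj : ∀ i ∈ T, j ≤ i) (hy : coboundary y (insert j T) = 0) :
    coboundary (fun S => if j ∈ S then 0 else y (insert j S)) T = y T := by
  by_cases hjT : j ∈ T
  · rw [coboundary, Finset.sum_eq_single j]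
    · rw [faceSign_eq_one hj]
      simp [Finset.insert_erase hjT]
    · intro t _ ht
      rw [if_pos (Finset.mem_erase.2 ⟨ht.symm, hjT⟩), smul_zero]
    · exact fun h => absurd hjT h
  -- The cocycle condition on `insert j T` expresses `y T` through the other faces; inserting `j`
  -- below each `t` accounts for the change of sign.
  · rw [coboundary, Finset.sum_insert hjT, faceSign_eq_one (by simpa using hj), one_smul,
      Finset.erase_insert hjT, add_eq_zero_iff_eq_neg] at hy
    rw [hy, coboundary, ← Finset.sum_neg_distrib]
    refine Finset.sum_congr rfl fun t ht => ?_
    have htj : j < t := lt_of_le_of_ne (hj t ht) (by rintro rfl; exact hjT ht)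
    have h1 := faceSign_erase_of_gt (Finset.mem_insert_self j T) htj
    rw [Finset.erase_insert hjT] at h1
    rw [if_neg fun h => hjT (Finset.mem_of_mem_erase h), h1, neg_smul,
      Finset.erase_insert_of_ne htj.ne]

/-! ### Complements of monomial ideals are finite unions of boxes -/

/-- Finite unions of boxes. -/
def IsBoxUnion {m : ℕ} (E : Set (Fin m →₀ ℕ)) : Prop :=
  ∃ F : Finset (Fin m → ℕ∞), E = ⋃ β ∈ F, box β

theorem isBoxUnion_univ {m : ℕ} : IsBoxUnion (Set.univ : Set (Fin m →₀ ℕ)) :=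
  ⟨{⊤}, by ext n; simp [box]⟩

theorem IsBoxUnion.inter {m : ℕ} {E E' : Set (Fin m →₀ ℕ)} (h : IsBoxUnion E)
    (h' : IsBoxUnion E') : IsBoxUnion (E ∩ E') := by
  classical
  obtain ⟨F, rfl⟩ := h
  obtain ⟨F', rfl⟩ := h'
  refine ⟨Finset.image₂ (· ⊓ ·) F F', ?_⟩
  ext n
  simp only [Set.mem_inter_iff, Set.mem_iUnion, Finset.mem_image₂, exists_prop]
  constructor
  · rintro ⟨⟨β, hβ, h⟩, γ, hγ, h'⟩
    exact ⟨β ⊓ γ, ⟨β, hβ, γ, hγ, rfl⟩, by rw [box_inf]; exact ⟨h, h'⟩⟩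
  · rintro ⟨_, ⟨β, hβ, γ, hγ, rfl⟩, h⟩
    rw [box_inf] at h
    exact ⟨⟨β, hβ, h.1⟩, γ, hγ, h.2⟩

/-- An exponent fails to dominate `a` exactly when some coordinate with `a i ≠ 0` is at most `a i -
1`. Each such `i` gives a box with one bound; coordinates with `a i = 0` are never violated and must
be left out because of truncated subtraction. -/
theorem isBoxUnion_compl_Ici {m : ℕ} (a : Fin m →₀ ℕ) : IsBoxUnion (Set.Ici a)ᶜ := by
  classical
  refine ⟨(Finset.univ.filter fun i => a i ≠ 0).image
    fun i => Function.update ⊤ i ((a i - 1 : ℕ) : ℕ∞), ?_⟩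
  ext n
  simp only [Set.mem_compl_iff, Set.mem_Ici, Set.mem_iUnion, Finset.mem_image, Finset.mem_filter,
    Finset.mem_univ, true_and, exists_prop, box, Set.mem_ofPred_eq, Finsupp.le_def, not_forall,
    not_le]
  constructor
  · rintro ⟨i, hi⟩
    refine ⟨_, ⟨i, by omega, rfl⟩, fun j => ?_⟩
    rcases eq_or_ne j i with rfl | hj
    · rw [Function.update_self]
      exact_mod_cast (by omega : n j ≤ a j - 1)
    · simp [Function.update_of_ne hj]
  · rintro ⟨_, ⟨i, hi, rfl⟩, h⟩
    have := h i
    rw [Function.update_self] at this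
    have : n i ≤ a i - 1 := by exact_mod_cast this
    exact ⟨i, by omega⟩

/-- Dickson's lemma: the minimal elements form an antichain in a well-quasi-order, hence a finite
set, and `U` is the union of the cones above them. The complement is a finite intersection of unions
of boxes. -/
theorem isBoxUnion_compl_of_isUpperSet {m : ℕ} {U : Set (Fin m →₀ ℕ)} (hU : IsUpperSet U) :
    IsBoxUnion Uᶜ := by
  classical
  have hfin : {n | Minimal (· ∈ U) n}.Finite :=
    WellQuasiOrderedLE.finite_of_isAntichain (setOfPred_minimal_antichain _)
  have hU' : U = ⋃ a ∈ hfin.toFinset, Set.Ici a := by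
    ext n
    simp only [Set.mem_iUnion, Set.Finite.mem_toFinset, Set.mem_ofPred_eq, Set.mem_Ici,
      exists_prop]
    constructor
    · intro hn
      obtain ⟨a, han, ha⟩ := exists_minimal_le_of_wellFoundedLT (· ∈ U) n hn
      exact ⟨a, ha, han⟩
    · rintro ⟨a, ha, han⟩
      exact hU han ha.prop
  rw [hU']
  generalize hfin.toFinset = F
  induction F using Finset.induction_on with
  | empty => simpa using isBoxUnion_univ
  | insert a F _ ih =>
    rw [Finset.set_biUnion_insert, Set.compl_union]
    exact (isBoxUnion_compl_Ici a).inter ih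


/-! ### Fourier coefficients of holomorphic functions on circles -/

/-- The character `x ↦ exp (2πix)` of the circle. -/
def circleExp (x : UnitAddCircle) : ℂ := fourier 1 x

theorem continuous_circleExp : Continuous circleExp := (fourier 1).continuous

@[simp]
theorem norm_circleExp (x : UnitAddCircle) : ‖circleExp x‖ = 1 := Circle.norm_coe _

theorem circleExp_add (x y : UnitAddCircle) : circleExp (x + y) = circleExp x * circleExp y := by
  simp only [circleExp, fourier_one, AddCircle.toCircle_add]
  rfl

@[simp]
theorem circleExp_zero : circleExp 0 = 1 := fourier_eval_zero 1

theorem fourier_natCast (k : ℕ) (x : UnitAddCircle) : fourier (k : ℤ) x = circleExp x ^ k := by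
  induction k with
  | zero => simp only [Nat.cast_zero, fourier_zero, pow_zero]
  | succ k ih => rw [Nat.cast_succ, fourier_add, ih, pow_succ, circleExp]

theorem circleExp_coe (t : ℝ) :
    circleExp (t : UnitAddCircle) = Complex.exp ((2 * Real.pi * t : ℝ) * Complex.I) := by
  rw [circleExp, fourier_coe_apply]
  congr 1
  push_cast
  ring

/-- This is the mean value property, rescaled from `[0, 2π]` to `[0, 1]`. -/
theorem fourierCoeff_zero_comp_circleExp {h : ℂ → ℂ} {s : Set ℂ} (hs : IsOpen s)
    (hsub : Metric.closedBall 0 1 ⊆ s) (hd : DifferentiableOn ℂ h s) :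
    fourierCoeff (fun x : UnitAddCircle => h (circleExp x)) 0 = h 0 := by
  have havg := circleAverage_of_differentiable_on_off_countable (s := ∅) (R := 1) (c := 0)
    (f := h) Set.countable_empty
    (fun u hu => (hd.continuousOn.mono (by simpa using hsub)) u hu)
    (fun u hu => hd.differentiableAt (hs.mem_nhds (hsub (by
      simpa using Metric.ball_subset_closedBall hu.1))))
  rw [← havg, Real.circleAverage_def, fourierCoeff_eq_intervalIntegral _ _ 0]
  have h1 := intervalIntegral.smul_integral_comp_mul_left (a := 0) (b := 1)
    (fun θ => h (circleMap 0 1 θ)) (2 * Real.pi)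
  rw [mul_zero, mul_one] at h1
  rw [← h1, inv_smul_smul₀ (by positivity)]
  simp only [neg_zero, div_one, one_smul, zero_add, fourier_zero]
  refine intervalIntegral.integral_congr fun t _ => ?_
  simp only [circleExp_coe, circleMap, one_mul, zero_add, Complex.ofReal_one]

theorem continuous_comp_smul_circleExp {h : ℂ → ℂ} {s : Set ℂ}
    (hsub : Metric.closedBall 0 1 ⊆ s) (hd : DifferentiableOn ℂ h s) {l : ℂ} (hl : ‖l‖ ≤ 1) :
    Continuous fun x : UnitAddCircle => h (l * circleExp x) := by
  refine hd.continuousOn.comp_continuous ?_ fun x => hsub ?_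
  · exact continuous_const.mul continuous_circleExp
  · simpa using hl

theorem fourierCoeff_const_of_ne_zero (c : ℂ) {n : ℤ} (hn : n ≠ 0) :
    fourierCoeff (fun _ : UnitAddCircle => c) n = 0 := by
  have h := orthonormal_iff_ite.1 (orthonormal_fourier (T := 1)) n 0
  rw [if_neg hn, ContinuousMap.inner_toLp] at h
  simp only [← fourier_neg, fourier_zero] at h
  simp only [fourierCoeff, smul_eq_mul, integral_mul_const]
  simp only [one_mul] at h
  rw [h, zero_mul]

theorem fourierCoeff_circleExp_mul (f : UnitAddCircle → ℂ) (n : ℤ) :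
    fourierCoeff (fun x => circleExp x * f x) n = fourierCoeff f (n - 1) := by
  refine integral_congr_ae (ae_of_all _ fun x => ?_)
  simp only [smul_eq_mul]
  rw [show -(n - 1) = -n + 1 by ring, fourier_add, ← circleExp, mul_assoc]

theorem dslope_decomp (h : ℂ → ℂ) (u : ℂ) : h u = h 0 + u * dslope h 0 u := by
  have := sub_smul_dslope h 0 u
  simp only [sub_zero, smul_eq_mul] at this
  rw [this]; ring

theorem fourierCoeff_circleExp_pow_mul_const (c : ℂ) {k : ℕ} {n : ℤ} (hn : n ≠ k) :
    fourierCoeff (fun x => circleExp x ^ k * c) n = 0 := by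
  induction k generalizing n with
  | zero => simpa using fourierCoeff_const_of_ne_zero c (by simpa using hn)
  | succ k ih =>
    simp only [pow_succ', mul_assoc]
    rw [fourierCoeff_circleExp_mul]
    exact ih (by push_cast at hn; omega)

/-- Write `h u = h 0 + u * dslope h 0 u`: the constant has no coefficient of positive index, and the
factor `u` shifts the index. As `dslope h 0` is again holomorphic, this gives a recursion that
avoids power series. -/
theorem fourierCoeff_succ_comp_circleExp {h : ℂ → ℂ} {s : Set ℂ} (hs : IsOpen s)
    (hsub : Metric.closedBall 0 1 ⊆ s) (hd : DifferentiableOn ℂ h s) {l : ℂ} (hl : ‖l‖ ≤ 1)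
    (k : ℕ) :
    fourierCoeff (fun x : UnitAddCircle => h (l * circleExp x)) (k + 1 : ℕ) =
      l * fourierCoeff (fun x : UnitAddCircle => dslope h 0 (l * circleExp x)) k := by
  have h0 : s ∈ 𝓝 (0 : ℂ) := hs.mem_nhds (hsub (by simp))
  have hd' := (Complex.differentiableOn_dslope h0).2 hd
  have hc := continuous_comp_smul_circleExp hsub hd' hl
  have h1 : (fun x : UnitAddCircle => h (l * circleExp x)) =
      (fun _ => h 0) + l • fun x : UnitAddCircle =>
        circleExp x * dslope h 0 (l * circleExp x) := by
    funext x
    simp only [Pi.add_apply, Pi.smul_apply, smul_eq_mul]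
    rw [dslope_decomp h]; ring
  have h2 : Integrable (l • fun x : UnitAddCircle => circleExp x * dslope h 0 (l * circleExp x))
      AddCircle.haarAddCircle :=
    ((continuous_circleExp.mul hc).const_smul l).integrable_of_hasCompactSupport
      (HasCompactSupport.of_compactSpace _)
  rw [h1, fourierCoeff.add (integrable_const _) h2, Pi.add_apply, fourierCoeff_const_of_ne_zero _ (by positivity), zero_add,
    fourierCoeff.const_smul, fourierCoeff_circleExp_mul, smul_eq_mul]
  simp

theorem fourierCoeff_comp_smul_circleExp {h : ℂ → ℂ} {s : Set ℂ} (hs : IsOpen s)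
    (hsub : Metric.closedBall 0 1 ⊆ s) (hd : DifferentiableOn ℂ h s) {l : ℂ} (hl : ‖l‖ ≤ 1)
    (k : ℕ) :
    fourierCoeff (fun x : UnitAddCircle => h (l * circleExp x)) k =
      l ^ k * fourierCoeff (fun x : UnitAddCircle => h (circleExp x)) k := by
  have h0 : s ∈ 𝓝 (0 : ℂ) := hs.mem_nhds (hsub (by simp))
  induction k generalizing h with
  | zero =>
    have h1 := fourierCoeff_zero_comp_circleExp (h := fun u => h (l * u))
      (s := (fun u => l * u) ⁻¹' s) (hs.preimage (by fun_prop))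
      (fun u hu => hsub (by
        simp only [mem_closedBall_zero_iff, norm_mul] at hu ⊢
        exact mul_le_one₀ hl (norm_nonneg _) hu))
      (hd.comp (by fun_prop) fun u hu => hu)
    simp only [Nat.cast_zero, pow_zero, one_mul, h1, fourierCoeff_zero_comp_circleExp hs hsub hd,
      mul_zero]
  | succ k ih =>
    have hd' := (Complex.differentiableOn_dslope h0).2 hd
    have h1 := fourierCoeff_succ_comp_circleExp hs hsub hd (l := 1) (by simp) k
    simp only [one_mul] at h1
    rw [fourierCoeff_succ_comp_circleExp hs hsub hd hl, ih hd', h1]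
    ring

/-- Coefficient `-1` of `h` is coefficient `0` of `u * h u`, which is the value of that function at
the origin. Repeating the shift reaches all negative indices. -/
theorem fourierCoeff_comp_circleExp_of_neg {h : ℂ → ℂ} {s : Set ℂ} (hs : IsOpen s)
    (hsub : Metric.closedBall 0 1 ⊆ s) (hd : DifferentiableOn ℂ h s) {n : ℤ} (hn : n < 0) :
    fourierCoeff (fun x : UnitAddCircle => h (circleExp x)) n = 0 := by
  obtain ⟨k, rfl⟩ : ∃ k : ℕ, n = -((k : ℤ) + 1) := ⟨(-n - 1).toNat, by omega⟩
  clear hn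
  induction k generalizing h with
  | zero =>
    have h1 := fourierCoeff_circleExp_mul (fun x => h (circleExp x)) 0
    have h2 := fourierCoeff_zero_comp_circleExp (h := fun u => u * h u) hs hsub
      (differentiableOn_id.mul hd)
    simp only [zero_mul] at h2
    rw [← h2, h1]
    simp
  | succ k ih =>
    have h1 := fourierCoeff_circleExp_mul (fun x => h (circleExp x)) (-((k : ℤ) + 1))
    have h2 := ih (h := fun u => u * h u) (differentiableOn_id.mul hd)
    rw [← h2, h1]
    congr 1

/-! ### Rotations -/

/-- The action of the torus on `ℂ^m` by coordinatewise rotations. -/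
def torusRot {m : ℕ} (x : UnitAddTorus (Fin m)) (z : Fin m → ℂ) : Fin m → ℂ :=
  fun i => circleExp (x i) * z i

/-- The normalized Haar measure of the torus. -/
def torusMeasure (m : ℕ) : Measure (UnitAddTorus (Fin m)) :=
  Measure.pi fun _ => AddCircle.haarAddCircle

instance (m : ℕ) : IsProbabilityMeasure (torusMeasure m) := by
  unfold torusMeasure; infer_instance

instance (m : ℕ) : (torusMeasure m).IsAddHaarMeasure := by
  unfold torusMeasure; infer_instance

theorem continuous_torusRot (m : ℕ) :
    Continuous fun p : UnitAddTorus (Fin m) × (Fin m → ℂ) => torusRot p.1 p.2 := by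
  refine continuous_pi fun i => Continuous.mul ?_ (by fun_prop)
  exact continuous_circleExp.comp ((continuous_apply i).comp continuous_fst)

theorem torusRot_mem_unitBall {m : ℕ} (x : UnitAddTorus (Fin m)) {z : Fin m → ℂ} :
    torusRot x z ∈ unitBall m ↔ z ∈ unitBall m := by
  simp [unitBall, torusRot]

theorem measurePreserving_torusRot {m : ℕ} (x : UnitAddTorus (Fin m)) :
    MeasurePreserving (torusRot x) (ballMeasure m) (ballMeasure m) := by
  have h : MeasurePreserving (torusRot x) volume volume :=
    volume_preserving_pi fun i => (rotation (AddCircle.toCircle ((1 : ℤ) • x i))).measurePreserving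
  have h2 := h.restrict_preimage (isOpen_unitBall m).measurableSet
  have h3 : torusRot x ⁻¹' unitBall m = unitBall m := by
    ext z; exact torusRot_mem_unitBall x
  rw [h3] at h2
  rw [ballMeasure_eq]
  exact h2.smul_measure _

/-- Each rotation preserves the ball measure, so Fubini gives the claim. The joint integrability it
needs holds because `(x, z) ↦ (x, torusRot x z)` preserves the product measure. -/
theorem integral_torusRot {m : ℕ} {Φ : (Fin m → ℂ) → ℂ} (hΦ : Integrable Φ (ballMeasure m)) :
    ∫ z, ∫ x, Φ (torusRot x z) ∂(torusMeasure m) ∂(ballMeasure m) = ∫ z, Φ z ∂(ballMeasure m) := by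
  have h1 : MeasurePreserving (fun p : UnitAddTorus (Fin m) × (Fin m → ℂ) =>
      (p.1, torusRot p.1 p.2)) ((torusMeasure m).prod (ballMeasure m))
      ((torusMeasure m).prod (ballMeasure m)) :=
    (MeasurePreserving.id _).skew_product (g := torusRot) (continuous_torusRot m).measurable
      (ae_of_all _ fun x => (measurePreserving_torusRot x).map_eq)
  have h2 : Integrable (fun p : UnitAddTorus (Fin m) × (Fin m → ℂ) => Φ (torusRot p.1 p.2))
      ((torusMeasure m).prod (ballMeasure m)) :=
    h1.integrable_comp_of_integrable (hΦ.comp_snd (torusMeasure m))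
  rw [← integral_integral_swap (f := fun x z => Φ (torusRot x z)) h2]
  have h3 : ∀ x, ∫ z, Φ (torusRot x z) ∂(ballMeasure m) = ∫ z, Φ z ∂(ballMeasure m) := fun x => by
    have h4 := (measurePreserving_torusRot x).map_eq
    conv_rhs => rw [← h4]
    exact (integral_map (measurePreserving_torusRot x).aemeasurable (by rw [h4]; exact hΦ.1)).symm
  simp [h3]

/-! ### Fourier coefficients on the torus -/

/-- The Fourier coefficients of `g` on the orbit of `z` under the torus. -/
def orbitCoeff {m : ℕ} (g : (Fin m → ℂ) → ℂ) (n : Fin m → ℤ) (z : Fin m → ℂ) : ℂ :=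
  ∫ x, UnitAddTorus.mFourier (-n) x * g (torusRot x z) ∂(torusMeasure m)

/-- Translation invariance of Haar measure in one coordinate makes one-variable Fourier coefficients
available on the torus. -/
theorem integral_torus_average_coord {m : ℕ} (i : Fin m) {F : UnitAddTorus (Fin m) → ℂ}
    (hF : Continuous F) :
    ∫ x, ∫ s, F (x + Pi.single i s) ∂AddCircle.haarAddCircle ∂(torusMeasure m) =
      ∫ x, F x ∂(torusMeasure m) := by
  have hc : Continuous fun p : UnitAddTorus (Fin m) × UnitAddCircle => F (p.1 + Pi.single i p.2) :=
    hF.comp (continuous_fst.add ((continuous_single i).comp continuous_snd))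
  rw [integral_integral_swap (hc.integrable_of_hasCompactSupport
    (HasCompactSupport.of_compactSpace _))]
  have : ∀ s, ∫ x, F (x + Pi.single i s) ∂(torusMeasure m) = ∫ x, F x ∂(torusMeasure m) :=
    fun s => integral_add_right_eq_self F _
  simp [this]

theorem mFourier_add_single {m : ℕ} (n : Fin m → ℤ) (i : Fin m) (x : UnitAddTorus (Fin m))
    (s : UnitAddCircle) :
    UnitAddTorus.mFourier n (x + Pi.single i s) =
      UnitAddTorus.mFourier n x * fourier (n i) s := by
  simp only [UnitAddTorus.mFourier, ContinuousMap.coe_mk]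
  have h : ∀ j, fourier (n j) ((x + Pi.single i s : UnitAddTorus (Fin m)) j) =
      fourier (n j) (x j) * (if j = i then fourier (n i) s else 1 : ℂ) := by
    intro j
    by_cases hj : j = i
    · subst hj
      simp only [Pi.add_apply, Pi.single_eq_same, if_true, fourier_apply, smul_add,
        AddCircle.toCircle_add]
      rfl
    · simp [hj]
  rw [Finset.prod_congr rfl fun j _ => h j, Finset.prod_mul_distrib]
  simp

theorem torusRot_add_single {m : ℕ} (i : Fin m) (x : UnitAddTorus (Fin m)) (s : UnitAddCircle)
    (z : Fin m → ℂ) :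
    torusRot (x + Pi.single i s) z =
      Function.update (torusRot x z) i (circleExp s * torusRot x z i) := by
  funext j
  by_cases hj : j = i
  · subst hj
    simp [torusRot, circleExp_add]; ring
  · simp [torusRot, hj]

theorem torusRot_update {m : ℕ} (i : Fin m) (x : UnitAddTorus (Fin m)) (l : ℂ)
    (z : Fin m → ℂ) :
    torusRot x (Function.update z i (l * z i)) =
      Function.update (torusRot x z) i (l * torusRot x z i) := by
  funext j
  by_cases hj : j = i
  · subst hj
    simp [torusRot]; ring
  · simp [torusRot, hj]

theorem update_mem_unitBall {m : ℕ} {z : Fin m → ℂ} (hz : z ∈ unitBall m) (i : Fin m) {l : ℂ}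
    (hl : ‖l‖ ≤ 1) : Function.update z i (l * z i) ∈ unitBall m := by
  have hz' : ∑ j, ‖z j‖ ^ 2 < 1 := hz
  refine lt_of_le_of_lt (Finset.sum_le_sum fun j _ => ?_) hz'
  by_cases hj : j = i
  · subst hj
    rw [Function.update_self, norm_mul]
    gcongr
    exact mul_le_of_le_one_left (norm_nonneg _) hl
  · rw [Function.update_of_ne hj]

theorem continuous_orbit {m : ℕ} {g : (Fin m → ℂ) → ℂ} (hg : DifferentiableOn ℂ g (unitBall m))
    {z : Fin m → ℂ} (hz : z ∈ unitBall m) :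
    Continuous fun x : UnitAddTorus (Fin m) => g (torusRot x z) :=
  hg.continuousOn.comp_continuous
    ((continuous_torusRot m).comp (continuous_id.prodMk continuous_const))
    fun x => (torusRot_mem_unitBall x).2 hz

/-- The slice of the ball through `z` in the direction of the `i`-th coordinate. -/
theorem slice_differentiableOn {m : ℕ} {g : (Fin m → ℂ) → ℂ}
    (hg : DifferentiableOn ℂ g (unitBall m)) (z : Fin m → ℂ) (i : Fin m) :
    DifferentiableOn ℂ (fun u : ℂ => g (Function.update z i (u * z i)))
      ((fun u : ℂ => Function.update z i (u * z i)) ⁻¹' unitBall m) := by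
  refine hg.comp ?_ fun u hu => hu
  refine differentiableOn_pi.2 fun j => ?_
  by_cases hj : j = i
  · subst hj; simp only [Function.update_self]; fun_prop
  · simp only [Function.update_of_ne hj]; fun_prop

theorem slice_isOpen {m : ℕ} (z : Fin m → ℂ) (i : Fin m) :
    IsOpen ((fun u : ℂ => Function.update z i (u * z i)) ⁻¹' unitBall m) := by
  refine (isOpen_unitBall m).preimage ?_
  exact continuous_const.update i (by fun_prop)

/-- The inner coefficient belongs to a function of one variable that is holomorphic near the closed
unit disc, so the circle lemmas apply coordinate by coordinate. -/
theorem orbitCoeff_eq_integral_slice {m : ℕ} {g : (Fin m → ℂ) → ℂ}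
    (hg : DifferentiableOn ℂ g (unitBall m)) (n : Fin m → ℤ) {z : Fin m → ℂ}
    (hz : z ∈ unitBall m) (i : Fin m) :
    orbitCoeff g n z = ∫ x, UnitAddTorus.mFourier (-n) x *
      fourierCoeff (fun s => g (Function.update (torusRot x z) i
        (circleExp s * torusRot x z i))) (n i) ∂(torusMeasure m) := by
  rw [orbitCoeff, ← integral_torus_average_coord i
    (F := fun x => UnitAddTorus.mFourier (-n) x * g (torusRot x z))
    ((UnitAddTorus.mFourier (-n)).continuous.mul (continuous_orbit hg hz))]
  refine integral_congr_ae (ae_of_all _ fun x => ?_)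
  simp only [mFourier_add_single, torusRot_add_single, fourierCoeff, smul_eq_mul, mul_assoc,
    integral_const_mul, Pi.neg_apply]

theorem orbitCoeff_update {m : ℕ} {g : (Fin m → ℂ) → ℂ}
    (hg : DifferentiableOn ℂ g (unitBall m)) (n : Fin m → ℕ) {z : Fin m → ℂ}
    (hz : z ∈ unitBall m) (i : Fin m) {l : ℂ} (hl : ‖l‖ ≤ 1) :
    orbitCoeff g (fun i => n i) (Function.update z i (l * z i)) =
      l ^ n i * orbitCoeff g (fun i => n i) z := by
  rw [orbitCoeff_eq_integral_slice hg _ (update_mem_unitBall hz i hl) i,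
    orbitCoeff_eq_integral_slice hg _ hz i, ← integral_const_mul]
  refine integral_congr_ae (ae_of_all _ fun x => ?_)
  have hx : torusRot x z ∈ unitBall m := (torusRot_mem_unitBall x).2 hz
  have h1 := fourierCoeff_comp_smul_circleExp (slice_isOpen (torusRot x z) i)
    (fun u hu => update_mem_unitBall hx i (by simpa using hu))
    (slice_differentiableOn hg (torusRot x z) i) hl (n i)
  simp only [torusRot_update, Function.update_idem, Function.update_self]
  rw [mul_left_comm, ← h1]
  simp only [mul_assoc, mul_left_comm l]

theorem orbitCoeff_of_neg {m : ℕ} {g : (Fin m → ℂ) → ℂ}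
    (hg : DifferentiableOn ℂ g (unitBall m)) {n : Fin m → ℤ} {z : Fin m → ℂ}
    (hz : z ∈ unitBall m) {i : Fin m} (hi : n i < 0) : orbitCoeff g n z = 0 := by
  rw [orbitCoeff_eq_integral_slice hg _ hz i]
  refine integral_eq_zero_of_ae (ae_of_all _ fun x => ?_)
  have hx : torusRot x z ∈ unitBall m := (torusRot_mem_unitBall x).2 hz
  have h1 := fourierCoeff_comp_circleExp_of_neg (slice_isOpen (torusRot x z) i)
    (fun u hu => update_mem_unitBall hx i (by simpa using hu))
    (slice_differentiableOn hg (torusRot x z) i) hi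
  simp only [h1, mul_zero, Pi.zero_apply]

theorem orbitCoeff_mul {m : ℕ} {g : (Fin m → ℂ) → ℂ}
    (hg : DifferentiableOn ℂ g (unitBall m)) (n : Fin m → ℕ) {z l : Fin m → ℂ}
    (hz : z ∈ unitBall m) (hl : ∀ i, ‖l i‖ ≤ 1) :
    orbitCoeff g (fun i => n i) (l * z) = (∏ i, l i ^ n i) * orbitCoeff g (fun i => n i) z := by
  classical
  -- The coordinates are scaled one at a time; membership in the ball is carried along because the
  -- one-coordinate lemma needs it at every intermediate point.
  suffices H : ∀ S : Finset (Fin m), (S.piecewise (l * z) z) ∈ unitBall m ∧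
      orbitCoeff g (fun i => n i) (S.piecewise (l * z) z) =
        (∏ i ∈ S, l i ^ n i) * orbitCoeff g (fun i => n i) z by
    simpa using (H Finset.univ).2
  intro S
  induction S using Finset.induction_on with
  | empty => simpa using hz
  | insert i S hi ih =>
    have h1 : (insert i S).piecewise (l * z) z = Function.update (S.piecewise (l * z) z) i
        (l i * S.piecewise (l * z) z i) := by
      rw [Finset.piecewise_insert, Finset.piecewise_eq_of_notMem _ _ _ hi, Pi.mul_apply]
    rw [h1]
    refine ⟨update_mem_unitBall ih.1 i (hl i), ?_⟩
    rw [orbitCoeff_update hg n ih.1 i (hl i), ih.2, Finset.prod_insert hi, mul_assoc]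

/-- A point without zero coordinates, at which no monomial vanishes; since `ε ≤ 1` it can also serve
as a multiplier. -/
theorem exists_const_mem_unitBall (m : ℕ) :
    ∃ ε : ℝ, 0 < ε ∧ ε ≤ 1 ∧ (fun _ => (ε : ℂ)) ∈ unitBall m := by
  have h1 : ∀ᶠ ε : ℝ in 𝓝[>] 0, (fun _ => (ε : ℂ)) ∈ unitBall m := by
    refine mem_nhdsWithin_of_mem_nhds ?_
    exact ((isOpen_unitBall m).preimage (f := fun (ε : ℝ) (_ : Fin m) => (ε : ℂ))
      (by fun_prop)).mem_nhds (by simp [unitBall])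
  have h2 : ∀ᶠ ε : ℝ in 𝓝[>] 0, ε ≤ 1 :=
    mem_nhdsWithin_of_mem_nhds (Iic_mem_nhds zero_lt_one)
  obtain ⟨ε, h⟩ := (h1.and (h2.and self_mem_nhdsWithin)).exists
  exact ⟨ε, h.2.2, h.2.1, h.1⟩

/-- The Fourier coefficients of a holomorphic function on the torus orbits are multiples of
monomials. -/
theorem exists_orbitCoeff_eq {m : ℕ} {g : (Fin m → ℂ) → ℂ}
    (hg : DifferentiableOn ℂ g (unitBall m)) (n : Fin m → ℕ) :
    ∃ a : ℂ, ∀ z ∈ unitBall m, orbitCoeff g (fun i => n i) z = a * ∏ i, z i ^ n i := by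
  obtain ⟨ε, hε0, hε1, hε⟩ := exists_const_mem_unitBall m
  refine ⟨orbitCoeff g (fun i => n i) (fun _ => (ε : ℂ)) / ∏ i, (ε : ℂ) ^ n i, fun z hz => ?_⟩
  -- The coefficient at the point `ε z` is computed twice, with `ε` scaling `z` and with `z` scaling
  -- the constant point `ε`.
  have h1 := orbitCoeff_mul hg n (z := z) (l := fun _ => (ε : ℂ)) hz
    (fun i => by simpa [abs_of_pos hε0] using hε1)
  have h2 := orbitCoeff_mul hg n (z := fun _ => (ε : ℂ)) (l := z) hε (fun i =>
    (norm_le_pi_norm z i).trans (by simpa using unitBall_subset m hz))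
  rw [mul_comm z, h1] at h2
  have h3 : (∏ i, (ε : ℂ) ^ n i) ≠ 0 :=
    Finset.prod_ne_zero_iff.2 fun i _ => pow_ne_zero _ (by exact_mod_cast hε0.ne')
  field_simp
  rw [mul_comm, h2, mul_comm]

/-! ### Orthogonality and completeness of the monomials -/

theorem inner_monomial {m : ℕ} (n : Fin m →₀ ℕ) (f : bergman m) {g : (Fin m → ℂ) → ℂ}
    (hfg : (f : Lp ℂ 2 (ballMeasure m)) =ᵐ[ballMeasure m] g) :
    Integrable (fun z => starRingEnd ℂ (∏ i, z i ^ n i) * g z) (ballMeasure m) ∧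
    ⟪polyIncl m (MvPolynomial.monomial n 1), f⟫_ℂ =
      ∫ z, starRingEnd ℂ (∏ i, z i ^ n i) * g z ∂(ballMeasure m) := by
  have h : (fun z => ⟪(polyIncl m (MvPolynomial.monomial n 1) : Lp ℂ 2 (ballMeasure m)) z,
      (f : Lp ℂ 2 (ballMeasure m)) z⟫_ℂ) =ᵐ[ballMeasure m]
      fun z => starRingEnd ℂ (∏ i, z i ^ n i) * g z := by
    filter_upwards [coeFn_polyIncl (MvPolynomial.monomial n 1), hfg] with z h1 h2
    rw [h1, h2, RCLike.inner_apply, mul_comm]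
    simp [MvPolynomial.eval_monomial, Finsupp.prod_fintype]
  refine ⟨(L2.integrable_inner _ _).congr h, ?_⟩
  rw [← integral_congr_ae h]
  rfl

/-- Rotation multiplies `z^n` by the character `n`, and its conjugate is the character `-n` in
`orbitCoeff`. -/
theorem integral_conj_monomial_mul_torusRot {m : ℕ} (n : Fin m →₀ ℕ) (g : (Fin m → ℂ) → ℂ)
    (z : Fin m → ℂ) :
    ∫ x, starRingEnd ℂ (∏ i, torusRot x z i ^ n i) * g (torusRot x z) ∂(torusMeasure m) =
      starRingEnd ℂ (∏ i, z i ^ n i) * orbitCoeff g (fun i => n i) z := by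
  rw [orbitCoeff, ← integral_const_mul]
  refine integral_congr_ae (ae_of_all _ fun x => ?_)
  have h : ∏ i, torusRot x z i ^ n i =
      UnitAddTorus.mFourier (fun i => (n i : ℤ)) x * ∏ i, z i ^ n i := by
    simp only [UnitAddTorus.mFourier, ContinuousMap.coe_mk, torusRot, mul_pow,
      Finset.prod_mul_distrib, fourier_natCast]
  simp only [h, map_mul]
  rw [UnitAddTorus.mFourier_neg]
  ring

/-- A continuous function that vanishes almost everywhere on an open set vanishes there, but a
monomial is nonzero at the constant point `ε`. -/
theorem polyIncl_monomial_ne_zero {m : ℕ} (n : Fin m →₀ ℕ) :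
    polyIncl m (MvPolynomial.monomial n 1) ≠ 0 := by
  intro h0
  have h1 : (fun z => MvPolynomial.eval z (MvPolynomial.monomial n (1 : ℂ)))
      =ᵐ[volume.restrict (unitBall m)] fun _ => 0 := by
    have h2 : (fun z => MvPolynomial.eval z (MvPolynomial.monomial n (1 : ℂ)))
        =ᵐ[ballMeasure m] fun _ => 0 := by
      have h3 := coeFn_polyIncl (MvPolynomial.monomial n (1 : ℂ))
      rw [h0] at h3
      exact h3.symm.trans (Lp.coeFn_zero _ _ _)
    rw [restrict_eq_smul]
    exact Measure.ae_smul_measure h2 _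
  have h2 := Measure.eqOn_open_of_ae_eq h1 (isOpen_unitBall m)
    (MvPolynomial.continuous_eval _).continuousOn continuousOn_const
  obtain ⟨ε, hε0, -, hε⟩ := exists_const_mem_unitBall m
  have h3 := h2 hε
  simp only [MvPolynomial.eval_monomial, Finsupp.prod_fintype, pow_zero, implies_true, one_mul]
    at h3
  exact (Finset.prod_ne_zero_iff.2 fun i _ =>
    pow_ne_zero (n i) (by exact_mod_cast hε0.ne' : (ε : ℂ) ≠ 0)) h3

/-- The orbit coefficient is `a z^n`, and averaging over the torus shows that `⟨z^n, f⟩ = a ‖z^n‖²`.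
Hence `a = 0`. -/
theorem orbitCoeff_natCast_eq_zero {m : ℕ} {f : bergman m}
    (hf : ∀ n, ⟪polyIncl m (MvPolynomial.monomial n 1), f⟫_ℂ = 0) {g : (Fin m → ℂ) → ℂ}
    (hg : DifferentiableOn ℂ g (unitBall m))
    (hfg : (f : Lp ℂ 2 (ballMeasure m)) =ᵐ[ballMeasure m] g) (n : Fin m → ℕ) {z : Fin m → ℂ}
    (hz : z ∈ unitBall m) : orbitCoeff g (fun i => n i) z = 0 := by
  obtain ⟨a, ha⟩ := exists_orbitCoeff_eq hg n
  suffices h : a = 0 by rw [ha z hz, h, zero_mul]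
  obtain ⟨N, rfl⟩ : ∃ N : Fin m →₀ ℕ, n = N := ⟨Finsupp.equivFunOnFinite.symm n, rfl⟩
  have h1 := inner_monomial N f hfg
  have h2 := inner_monomial N (polyIncl m (MvPolynomial.monomial N 1)) (coeFn_polyIncl _)
  have h3 : ∫ z, starRingEnd ℂ (∏ i, z i ^ N i) * g z ∂(ballMeasure m) =
      a * ∫ z, starRingEnd ℂ (∏ i, z i ^ N i) *
        MvPolynomial.eval z (MvPolynomial.monomial N 1) ∂(ballMeasure m) := by
    rw [← integral_torusRot h1.1, ← integral_const_mul]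
    refine integral_congr_ae ?_
    filter_upwards [ae_mem_unitBall m] with z hz
    rw [integral_conj_monomial_mul_torusRot N g z, ha z hz, MvPolynomial.eval_monomial,
      Finsupp.prod_fintype _ _ fun _ => pow_zero _, one_mul]
    ring
  rw [← h1.2, ← h2.2, hf N] at h3
  exact (mul_eq_zero.1 h3.symm).resolve_right
    (inner_self_eq_zero.not.2 (polyIncl_monomial_ne_zero N))

/-- Zero coefficients are summable, so the Fourier series converges uniformly to `φ`; its sum is
`0`. -/
theorem eq_zero_of_forall_mFourierCoeff {d : Type*} [Fintype d] {φ : C(UnitAddTorus d, ℂ)}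
    (h : ∀ n, UnitAddTorus.mFourierCoeff φ n = 0) : φ = 0 := by
  have h0 : UnitAddTorus.mFourierCoeff φ = fun _ => 0 := funext h
  have h1 := UnitAddTorus.hasSum_mFourier_series_of_summable (f := φ)
    (by rw [h0]; exact summable_zero)
  rw [h0] at h1
  refine h1.unique ?_
  convert! hasSum_zero (α := C(UnitAddTorus d, ℂ)) (β := d → ℤ) using 2
  exact zero_smul ℂ (UnitAddTorus.mFourier _)

/-- If the coefficients of `f` vanish, then `f = 0`: the monomials span a dense subspace of the
Bergman space. -/
theorem eq_zero_of_forall_inner_monomial {m : ℕ} {f : bergman m}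
    (hf : ∀ n, ⟪polyIncl m (MvPolynomial.monomial n 1), f⟫_ℂ = 0) : f = 0 := by
  obtain ⟨g, hg, hfg⟩ := f.2
  have hg0 : ∀ z ∈ unitBall m, g z = 0 := by
    intro z hz
    -- On the orbit of `z` all Fourier coefficients vanish: those with a negative index by
    -- holomorphy, the others by hypothesis. The value at `z` is the one at the identity of the
    -- torus.
    have hφ : (⟨_, continuous_orbit hg hz⟩ : C(UnitAddTorus (Fin m), ℂ)) = 0 := by
      refine eq_zero_of_forall_mFourierCoeff fun n => ?_
      by_cases hn : ∃ i, n i < 0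
      · obtain ⟨i, hi⟩ := hn
        exact orbitCoeff_of_neg hg hz hi
      · push Not at hn
        obtain ⟨k, rfl⟩ : ∃ k : Fin m → ℕ, n = fun i => (k i : ℤ) :=
          ⟨fun i => (n i).toNat, funext fun i => (Int.toNat_of_nonneg (hn i)).symm⟩
        exact orbitCoeff_natCast_eq_zero hf hg hfg k hz
    have h0 := DFunLike.congr_fun hφ 0
    have h1 : torusRot 0 z = z := by funext i; simp [torusRot]
    simpa only [ContinuousMap.coe_mk, h1, ContinuousMap.zero_apply] using h0
  refine bergman_ext ?_
  have h0 : ((0 : bergman m) : Lp ℂ 2 (ballMeasure m)) =ᵐ[ballMeasure m] 0 :=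
    Lp.coeFn_zero ℂ 2 (ballMeasure m)
  filter_upwards [hfg, ae_mem_unitBall m, h0] with z h1 hz h0
  rw [h1, h0, hg0 z hz, Pi.zero_apply]

/-- Average over a coordinate `i` in which the exponents differ: along it `z^k` is a constant times
`u ^ k i`, which has no coefficient of index `n i`. -/
theorem inner_monomial_of_ne {m : ℕ} {n k : Fin m →₀ ℕ} (hnk : n ≠ k) :
    ⟪polyIncl m (MvPolynomial.monomial n 1), polyIncl m (MvPolynomial.monomial k 1)⟫_ℂ = 0 := by
  obtain ⟨h1, h2⟩ := inner_monomial n (polyIncl m (MvPolynomial.monomial k 1)) (coeFn_polyIncl _)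
  obtain ⟨i, hi⟩ := DFunLike.ne_iff.1 hnk
  rw [h2, ← integral_torusRot h1]
  refine integral_eq_zero_of_ae ?_
  filter_upwards [ae_mem_unitBall m] with z hz
  have hd : DifferentiableOn ℂ (fun z : Fin m → ℂ =>
      MvPolynomial.eval z (MvPolynomial.monomial k (1 : ℂ))) (unitBall m) :=
    (AnalyticOnNhd.eval_mvPolynomial _).differentiableOn.mono (Set.subset_univ _)
  rw [integral_conj_monomial_mul_torusRot n
    (fun z => MvPolynomial.eval z (MvPolynomial.monomial k (1 : ℂ))) z,
    orbitCoeff_eq_integral_slice hd _ hz i]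
  refine mul_eq_zero_of_right _ (integral_eq_zero_of_ae (ae_of_all _ fun x => ?_))
  refine mul_eq_zero_of_right _ ?_
  set w := torusRot x z
  have h3 : ∀ u : ℂ, MvPolynomial.eval (Function.update w i (u * w i))
      (MvPolynomial.monomial k (1 : ℂ)) = u ^ k i * ∏ j, w j ^ k j := by
    intro u
    simp only [MvPolynomial.eval_monomial, Finsupp.prod_fintype, pow_zero, implies_true, one_mul]
    rw [← Finset.mul_prod_erase _ _ (Finset.mem_univ i),
      ← Finset.mul_prod_erase (a := i) Finset.univ (fun j => w j ^ k j) (Finset.mem_univ i),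
      Function.update_self, mul_pow, mul_assoc]
    congr 2
    refine Finset.prod_congr rfl fun j hj => ?_
    rw [Function.update_of_ne (Finset.ne_of_mem_erase hj)]
  simp only [h3]
  exact fourierCoeff_circleExp_pow_mul_const _ (by exact_mod_cast hi)


/-! ### Coefficients and projections -/

theorem omega_pos {m : ℕ} (n : Fin m →₀ ℕ) : 0 < omega n := by unfold omega; positivity

theorem coeff_eq_smul {m : ℕ} (n : Fin m →₀ ℕ) (f : bergman m) :
    coeff n f = ((Real.sqrt (omega n))⁻¹ : ℂ) *
      ⟪polyIncl m (MvPolynomial.monomial n 1), f⟫_ℂ := by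
  rw [coeff, basisVec, inner_smul_left, map_inv₀, Complex.conj_ofReal]

theorem coeff_eq_zero_iff {m : ℕ} {n : Fin m →₀ ℕ} {f : bergman m} :
    coeff n f = 0 ↔ ⟪polyIncl m (MvPolynomial.monomial n 1), f⟫_ℂ = 0 := by
  rw [coeff_eq_smul, mul_eq_zero, or_iff_right]
  exact inv_ne_zero (by exact_mod_cast (Real.sqrt_pos.2 (omega_pos n)).ne')

theorem coeff_eq_innerSL {m : ℕ} (n : Fin m →₀ ℕ) (f : bergman m) :
    coeff n f = innerSL ℂ (basisVec n) f := rfl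

theorem continuous_coeff {m : ℕ} (n : Fin m →₀ ℕ) : Continuous (coeff n) :=
  (innerSL ℂ (basisVec n)).continuous

theorem coeff_zero {m : ℕ} (n : Fin m →₀ ℕ) : coeff n 0 = 0 := inner_zero_right _

theorem coeff_sub {m : ℕ} (n : Fin m →₀ ℕ) (f g : bergman m) :
    coeff n (f - g) = coeff n f - coeff n g := inner_sub_right _ _ _

theorem coeff_sum {m : ℕ} {ι : Type*} (n : Fin m →₀ ℕ) (s : Finset ι) (f : ι → bergman m) :
    coeff n (∑ i ∈ s, f i) = ∑ i ∈ s, coeff n (f i) := inner_sum _ _ _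

theorem coeff_zsmul {m : ℕ} (n : Fin m →₀ ℕ) (c : ℤ) (f : bergman m) :
    coeff n (c • f) = c • coeff n f := by
  simp only [coeff_eq_innerSL, map_zsmul]

theorem bergman_ext_coeff {m : ℕ} {f g : bergman m} (h : ∀ n, coeff n f = coeff n g) : f = g := by
  rw [← sub_eq_zero]
  refine eq_zero_of_forall_inner_monomial fun n => coeff_eq_zero_iff.1 ?_
  rw [coeff_sub, h, sub_self]

theorem inner_basisVec_of_ne {m : ℕ} {n k : Fin m →₀ ℕ} (h : n ≠ k) :
    ⟪basisVec n, basisVec k⟫_ℂ = 0 := by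
  rw [basisVec, basisVec, inner_smul_left, inner_smul_right, inner_monomial_of_ne h, mul_zero,
    mul_zero]

/-- For `n ∈ E` orthogonality puts `basisVec n` in `K`, and `f` minus its projection is orthogonal
to `K`. -/
theorem coeff_orthogonalProjectionOnto {m : ℕ} {K : Submodule ℂ (bergman m)}
    [K.HasOrthogonalProjection] {E : Set (Fin m →₀ ℕ)}
    (hK : ∀ f, f ∈ K ↔ ∀ n, n ∉ E → coeff n f = 0) (f : bergman m) {n : Fin m →₀ ℕ} (hn : n ∈ E) :
    coeff n (K.orthogonalProjectionOnto f : bergman m) = coeff n f := by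
  have h1 : f - (K.orthogonalProjectionOnto f : bergman m) ∈ Kᗮ :=
    Submodule.sub_starProjection_mem_orthogonal f
  have h2 : basisVec n ∈ K :=
    (hK _).2 fun k hk => inner_basisVec_of_ne fun h => hk (h ▸ hn)
  have h3 := (Submodule.mem_orthogonal _ _).1 h1 _ h2
  rw [inner_sub_right, sub_eq_zero] at h3
  exact h3.symm

theorem coeff_boxProj {m : ℕ} (β : Fin m → ℕ∞) (f : bergman m) {n : Fin m →₀ ℕ}
    (hn : n ∈ box β) : coeff n (boxProj β f : bergman m) = coeff n f :=
  coeff_orthogonalProjectionOnto (fun _ => Iff.rfl) f hn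

theorem coeff_boxSpace {m : ℕ} {β : Fin m → ℕ∞} (f : boxSpace β) {n : Fin m →₀ ℕ}
    (hn : n ∉ box β) : coeff n (f : bergman m) = 0 := f.2 n hn

theorem boxSpace_ext {m : ℕ} {β : Fin m → ℕ∞} {f g : boxSpace β}
    (h : ∀ n ∈ box β, coeff n (f : bergman m) = coeff n (g : bergman m)) : f = g := by
  refine Subtype.ext (bergman_ext_coeff fun n => ?_)
  by_cases hn : n ∈ box β
  · exact h n hn
  · rw [coeff_boxSpace f hn, coeff_boxSpace g hn]

theorem isClosed_setOf_coeff_eq_zero {m : ℕ} (E : Set (Fin m →₀ ℕ)) :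
    IsClosed {f : bergman m | ∀ n ∉ E, coeff n f = 0} := by
  simp only [Set.ofPred_forall]
  exact isClosed_iInter fun n => isClosed_iInter fun _ =>
    isClosed_eq (continuous_coeff n) continuous_const

/-- For every set of exponents there is a projection onto the functions with these exponents. -/
theorem exists_coeff_proj {m : ℕ} (E : Set (Fin m →₀ ℕ)) (f : bergman m) :
    ∃ g : bergman m, (∀ n ∈ E, coeff n g = coeff n f) ∧ ∀ n ∉ E, coeff n g = 0 := by
  let K : Submodule ℂ (bergman m) := ⨅ n ∈ Eᶜ, (innerSL ℂ (basisVec n)).ker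
  have hK : ∀ f, f ∈ K ↔ ∀ n, n ∉ E → coeff n f = 0 := fun f => by
    simp only [K, Submodule.mem_iInf]
    exact Iff.rfl
  have hc : IsClosed (K : Set (bergman m)) := by
    rw [show (K : Set (bergman m)) = {f | ∀ n ∉ E, coeff n f = 0} from Set.ext hK]
    exact isClosed_setOf_coeff_eq_zero E
  have : CompleteSpace K := hc.completeSpace_coe
  exact ⟨K.orthogonalProjectionOnto f, fun n hn => coeff_orthogonalProjectionOnto hK f hn,
    (hK _).1 (K.orthogonalProjectionOnto f).2⟩

/-! ### The closure of a monomial ideal -/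

/-- The upper closure of `T` is the set of exponents of monomials in the ideal. The coefficient
condition is closed, so one direction need only be checked on polynomials; the other uses
completeness of the monomials. -/
theorem mem_idealClosure_iff {m : ℕ} (T : Set (Fin m →₀ ℕ)) (f : bergman m) :
    f ∈ idealClosure (Ideal.span ((fun n => MvPolynomial.monomial n (1 : ℂ)) '' T)) ↔
      ∀ n ∉ upperClosure T, coeff n f = 0 := by
  set I := Ideal.span ((fun n => MvPolynomial.monomial n (1 : ℂ)) '' T) with hI
  have hsub : ∀ f ∈ idealClosure I, ∀ n ∉ upperClosure T, coeff n f = 0 := by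
    refine fun f hf => closure_minimal ?_
      (isClosed_setOf_coeff_eq_zero (upperClosure T : Set (Fin m →₀ ℕ))) hf
    rintro _ ⟨p, hp, rfl⟩ n hn
    have hp' := MvPolynomial.mem_ideal_span_monomial_image.1 hp
    rw [p.as_sum, map_sum, coeff_sum]
    refine Finset.sum_eq_zero fun k hk => ?_
    have hnk : n ≠ k := by
      rintro rfl
      obtain ⟨t, ht, htn⟩ := hp' n hk
      exact hn (mem_upperClosure.2 ⟨t, ht, htn⟩)
    rw [show MvPolynomial.monomial k (MvPolynomial.coeff k p) =
        MvPolynomial.coeff k p • MvPolynomial.monomial k (1 : ℂ) by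
        rw [MvPolynomial.smul_monomial, smul_eq_mul, mul_one],
      LinearMap.map_smul_of_tower, coeff_eq_zero_iff, inner_smul_right, inner_monomial_of_ne hnk,
      mul_zero]
  refine ⟨hsub f, fun hf => ?_⟩
  set K : Submodule ℂ (bergman m) := Submodule.span ℂ
    ((fun n => polyIncl m (MvPolynomial.monomial n 1)) '' (upperClosure T : Set (Fin m →₀ ℕ)))
    with hK
  have hKI : ∀ g ∈ K.topologicalClosure, g ∈ idealClosure I := by
    intro g hg
    refine closure_mono (s := (K : Set (bergman m))) ?_ hg
    have hle : K ≤ (Submodule.map (polyIncl m) I).restrictScalars ℂ := by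
      refine Submodule.span_le.2 ?_
      rintro _ ⟨n, hn, rfl⟩
      obtain ⟨t, ht, htn⟩ := mem_upperClosure.1 hn
      refine Submodule.mem_map_of_mem (MvPolynomial.mem_ideal_span_monomial_image.2 fun k hk => ?_)
      have := MvPolynomial.support_monomial_subset hk
      rw [Finset.mem_singleton] at this
      exact ⟨t, ht, this ▸ htn⟩
    exact hle
  have : CompleteSpace K.topologicalClosure := K.isClosed_topologicalClosure.completeSpace_coe
  -- The part `g` orthogonal to `K` has no coefficient on the upper closure, by orthogonality, and
  -- none off it, since neither `h + g` nor `h` has any there.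
  obtain ⟨h, hh, g, hg, rfl⟩ := K.topologicalClosure.exists_add_mem_mem_orthogonal f
  rw [Submodule.orthogonal_closure] at hg
  have hg0 : g = 0 := by
    refine bergman_ext_coeff fun n => ?_
    rw [coeff_zero]
    by_cases hn : n ∈ upperClosure T
    · exact coeff_eq_zero_iff.2 ((Submodule.mem_orthogonal _ _).1 hg _
        (Submodule.subset_span ⟨n, hn, rfl⟩))
    · have h1 := hf n hn
      have h2 := hsub h (hKI h hh) n hn
      have h3 := coeff_sub n (h + g) h
      rwa [add_sub_cancel_left, h1, h2, sub_zero] at h3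
  rw [hg0, add_zero]
  exact hKI h hh

/-! ### The complex of box modules -/

/-- The module map between the box modules of two nested boxes. -/
noncomputable def boxRes {m : ℕ} {β γ : Fin m → ℕ∞} (h : γ ≤ β) :
    boxSpace β →L[MvPolynomial (Fin m) ℂ] boxSpace γ where
  toFun f := boxProj γ (f : bergman m)
  map_add' f g := by rw [Submodule.coe_add, map_add]
  map_smul' p f := by
    rw [RingHom.id_apply, boxSpace_smul_def, boxSpace_smul_def, boxProj_smul_boxProj]
    -- Projecting to the larger box first does not change the coefficients in the smaller one.
    refine boxSpace_ext fun n hn => ?_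
    rw [coeff_boxProj _ _ hn, coeff_boxProj _ _ hn,
      coeff_boxProj _ _ fun i => (hn i).trans (h i)]
  cont := (boxProj γ).continuous.comp continuous_subtype_val

/-- The `S`-component of an element of the direct sum. -/
noncomputable def boxSumProj {m k : ℕ} (β : Fin k → Fin m → ℕ∞) (q : ℕ) (S : {S : Finset (Fin k) // S.card = q}) :
    boxSum β q →L[MvPolynomial (Fin m) ℂ] boxSpace (S.1.inf β) where
  toFun x := x S
  map_add' _ _ := rfl
  map_smul' _ _ := rfl
  cont := (continuous_apply S).comp (PiLp.continuous_ofLp 2 _)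

/-- A family of module maps into the box modules defines a module map into their direct sum. -/
noncomputable def boxSumLift {m k : ℕ} {M : Type*} [AddCommGroup M] [TopologicalSpace M]
    [Module (MvPolynomial (Fin m) ℂ) M] (β : Fin k → Fin m → ℕ∞) (q : ℕ)
    (Φ : ∀ S : {S : Finset (Fin k) // S.card = q},
      M →L[MvPolynomial (Fin m) ℂ] boxSpace (S.1.inf β)) :
    M →L[MvPolynomial (Fin m) ℂ] boxSum β q where
  toFun x := WithLp.toLp 2 fun S => Φ S x
  map_add' x y := by ext S; simp
  map_smul' p x := by ext S; simp
  cont := (PiLp.continuous_toLp 2 _).comp (continuous_pi fun S => (Φ S).continuous)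

/-- The coboundary of the complex of box modules. -/
noncomputable def boxCoboundary {m k : ℕ} (β : Fin k → Fin m → ℕ∞) (q : ℕ) :
    boxSum β q →L[MvPolynomial (Fin m) ℂ] boxSum β (q + 1) :=
  boxSumLift β (q + 1) fun T => ∑ t ∈ T.1.attach, faceSign T.1 t.1 •
    (boxRes (Finset.inf_mono (Finset.erase_subset t.1 T.1))).comp
      (boxSumProj β q ⟨T.1.erase t.1, by rw [Finset.card_erase_of_mem t.2, T.2]; rfl⟩)

/-- The augmentation, which identifies the Bergman space with the box module of the empty
intersection. -/
noncomputable def boxAugmentation {m k : ℕ} (β : Fin k → Fin m → ℕ∞) :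
    bergman m →L[MvPolynomial (Fin m) ℂ] boxSum β 0 :=
  boxSumLift β 0 fun S =>
    { toFun f := boxProj (S.1.inf β) f
      map_add' f g := map_add _ f g
      map_smul' p f := by
        rw [RingHom.id_apply, boxSpace_smul_def, boxProj_smul_boxProj]
      cont := (boxProj _).continuous }

theorem boxAugmentation_surjective {m k : ℕ} (β : Fin k → Fin m → ℕ∞) :
    Function.Surjective (boxAugmentation β) := by
  intro y
  refine ⟨y ⟨∅, rfl⟩, ?_⟩
  ext1 S
  obtain ⟨S, hS⟩ := S
  obtain rfl := Finset.card_eq_zero.1 hS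
  exact boxProj_coe _ _

theorem mem_box_inf {m k : ℕ} {β : Fin k → Fin m → ℕ∞} {S : Finset (Fin k)} {n : Fin m →₀ ℕ} :
    n ∈ box (S.inf β) ↔ ∀ s ∈ S, n ∈ box (β s) := by
  rw [box_finset_inf]; simp only [Set.mem_iInter]

/-- The coefficients of `x` along a fixed monomial, as a cochain of a simplex. -/
noncomputable def boxCoeff {m k : ℕ} {β : Fin k → Fin m → ℕ∞} {q : ℕ} (x : boxSum β q) (n : Fin m →₀ ℕ)
    (S : Finset (Fin k)) : ℂ :=
  -- The default value `0` lets a cochain be a function on all finite sets, so the coboundary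
  -- formula holds for `T` of any size.
  if h : S.card = q then coeff n (x ⟨S, h⟩ : bergman m) else 0

theorem boxCoeff_of_card {m k : ℕ} {β : Fin k → Fin m → ℕ∞} {q : ℕ} (x : boxSum β q)
    (n : Fin m →₀ ℕ) {S : Finset (Fin k)} (h : S.card = q) :
    boxCoeff x n S = coeff n (x ⟨S, h⟩ : bergman m) := dif_pos h

theorem boxCoeff_of_card_ne {m k : ℕ} {β : Fin k → Fin m → ℕ∞} {q : ℕ} (x : boxSum β q)
    (n : Fin m →₀ ℕ) {S : Finset (Fin k)} (h : S.card ≠ q) : boxCoeff x n S = 0 := dif_neg h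

theorem boxCoeff_zero {m k : ℕ} {β : Fin k → Fin m → ℕ∞} {q : ℕ} (n : Fin m →₀ ℕ)
    (S : Finset (Fin k)) : boxCoeff (0 : boxSum β q) n S = 0 := by
  by_cases h : S.card = q
  · rw [boxCoeff_of_card _ _ h]; exact coeff_zero n
  · exact boxCoeff_of_card_ne _ _ h

theorem boxSum_ext {m k : ℕ} {β : Fin k → Fin m → ℕ∞} {q : ℕ} {x y : boxSum β q}
    (h : ∀ n S, n ∈ box (S.inf β) → boxCoeff x n S = boxCoeff y n S) : x = y := by
  ext1 S
  refine boxSpace_ext fun n hn => ?_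
  have := h n S.1 hn
  rwa [boxCoeff_of_card _ _ S.2, boxCoeff_of_card _ _ S.2] at this

/-- This turns identities between operators into simplicial identities at each exponent. Only `n` in
the box of `T` is allowed, since there the projections preserve coefficients. -/
theorem boxCoeff_boxCoboundary {m k : ℕ} {β : Fin k → Fin m → ℕ∞} {q : ℕ} (x : boxSum β q)
    {n : Fin m →₀ ℕ} {T : Finset (Fin k)} (hn : n ∈ box (T.inf β)) :
    boxCoeff (boxCoboundary β q x) n T = coboundary (boxCoeff x n) T := by
  by_cases hT : T.card = q + 1
  · have h1 : (boxCoboundary β q x ⟨T, hT⟩ : bergman m) = ∑ t ∈ T.attach, faceSign T t.1 •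
        (boxProj (T.inf β) (x ⟨T.erase t.1, by rw [Finset.card_erase_of_mem t.2, hT]; rfl⟩) :
          bergman m) := by
      simp [boxCoboundary, boxSumLift, boxRes]
      rfl
    rw [boxCoeff_of_card _ _ hT, h1, coeff_sum, coboundary, ← Finset.sum_attach T]
    refine Finset.sum_congr rfl fun t _ => ?_
    rw [coeff_zsmul, coeff_boxProj _ _ hn, boxCoeff_of_card]
  · rw [boxCoeff_of_card_ne _ _ hT, coboundary]
    refine (Finset.sum_eq_zero fun t ht => ?_).symm
    rw [boxCoeff_of_card_ne, smul_zero]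
    rw [Finset.card_erase_of_mem ht]
    have := Finset.card_pos.2 ⟨t, ht⟩
    omega

theorem boxCoeff_boxAugmentation {m k : ℕ} (β : Fin k → Fin m → ℕ∞) (f : bergman m)
    (n : Fin m →₀ ℕ) : boxCoeff (boxAugmentation β f) n ∅ = coeff n f := by
  rw [boxCoeff_of_card _ _ Finset.card_empty]
  exact coeff_boxProj _ _ (mem_box_inf.2 (by simp))

/-! ### Exactness of the complex -/

theorem boxCoboundary_boxCoboundary {m k : ℕ} {β : Fin k → Fin m → ℕ∞} {q : ℕ}
    (x : boxSum β q) : boxCoboundary β (q + 1) (boxCoboundary β q x) = 0 := by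
  refine boxSum_ext fun n T hn => ?_
  rw [boxCoeff_boxCoboundary _ hn, boxCoeff_zero, ← coboundary_coboundary (boxCoeff x n) T]
  refine Finset.sum_congr rfl fun t _ => ?_
  rw [boxCoeff_boxCoboundary]
  exact mem_box_inf.2 fun s hs => mem_box_inf.1 hn s (Finset.mem_of_mem_erase hs)

/-- The contraction of the complex, on every monomial onto the first box that contains it. -/
theorem exists_contraction {m k : ℕ} {β : Fin k → Fin m → ℕ∞} {q : ℕ} (y : boxSum β (q + 1)) :
    ∃ x : boxSum β q, ∀ (n : Fin m →₀ ℕ) (j : Fin k), n ∈ box (β j) →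
      (∀ i < j, n ∉ box (β i)) → ∀ S : Finset (Fin k), n ∈ box (S.inf β) →
        boxCoeff x n S = if j ∈ S then 0 else boxCoeff y n (insert j S) := by
  -- `P j` keeps the exponents whose first box is `j`. These sets are disjoint, so at a given
  -- exponent only one term of the finite sum below survives, and the contraction with its varying
  -- vertex `j` is a genuine element of the direct sum.
  choose P hP hP' using fun j : Fin k =>
    exists_coeff_proj {n : Fin m →₀ ℕ | n ∈ box (β j) ∧ ∀ i < j, n ∉ box (β i)}
  refine ⟨WithLp.toLp 2 fun S => boxProj (S.1.inf β) (∑ j : Fin k, if hj : j ∈ S.1 then 0 else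
    P j (y ⟨insert j S.1, by rw [Finset.card_insert_of_notMem hj, S.2]⟩)), ?_⟩
  intro n j hj hlt S hS
  by_cases hq : S.card = q
  · rw [boxCoeff_of_card _ _ hq]
    change coeff n (boxProj (S.inf β) _ : bergman m) = _
    rw [coeff_boxProj _ _ hS, coeff_sum, Finset.sum_eq_single j]
    · by_cases hjS : j ∈ S
      · simp only [dif_pos hjS, if_pos hjS, coeff_zero]
      · simp only [dif_neg hjS, if_neg hjS]
        rw [hP j _ n ⟨hj, hlt⟩, boxCoeff_of_card]
    · intro i _ hij
      by_cases hiS : i ∈ S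
      · simp only [dif_pos hiS, coeff_zero]
      · simp only [dif_neg hiS]
        refine hP' i _ n fun h => ?_
        rcases lt_or_gt_of_ne hij with h' | h'
        · exact hlt i h' h.1
        · exact h.2 j h' hj
    · exact fun h => absurd (Finset.mem_univ j) h
  · rw [boxCoeff_of_card_ne _ _ hq]
    split_ifs with hjS
    · rfl
    · rw [boxCoeff_of_card_ne]
      rw [Finset.card_insert_of_notMem hjS]
      omega

/-- At each exponent the cocycle `y` is the coboundary of its contraction onto the first box
containing that exponent. -/
theorem exact_boxCoboundary {m k : ℕ} (β : Fin k → Fin m → ℕ∞) (q : ℕ) :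
    Function.Exact (boxCoboundary β q) (boxCoboundary β (q + 1)) := by
  intro y
  constructor
  · intro hy
    obtain ⟨x, hx⟩ := exists_contraction y
    refine ⟨x, boxSum_ext fun n T hn => ?_⟩
    rw [boxCoeff_boxCoboundary _ hn]
    rcases T.eq_empty_or_nonempty with rfl | ⟨t, ht⟩
    -- The empty set has no vertex to contract onto, but `y` lives in positive degree and has no
    -- component there.
    · rw [boxCoeff_of_card_ne _ _ (by simp), coboundary, Finset.sum_empty]
    obtain ⟨j, -, hmin⟩ := exists_minimal_le_of_wellFoundedLT (fun s => n ∈ box (β s)) t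
      (mem_box_inf.1 hn t ht)
    have hj : n ∈ box (β j) := hmin.prop
    have hlt : ∀ i < j, n ∉ box (β i) := fun i hi h => not_lt_of_ge (hmin.le_of_le h hi.le) hi
    have hle : ∀ i ∈ T, j ≤ i := fun i hi =>
      not_lt.1 fun h => hlt i h (mem_box_inf.1 hn i hi)
    -- The exponent lies in the box of `j` too, so the cocycle condition is available on `insert j
    -- T`.
    have hins : n ∈ box ((insert j T).inf β) := mem_box_inf.2 fun s hs => by
      rcases Finset.mem_insert.1 hs with rfl | hs
      · exact hj
      · exact mem_box_inf.1 hn s hs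
    have hy' : coboundary (boxCoeff y n) (insert j T) = 0 := by
      rw [← boxCoeff_boxCoboundary _ hins, hy, boxCoeff_zero]
    rw [← coboundary_contraction hle hy']
    refine Finset.sum_congr rfl fun t _ => ?_
    rw [hx n j hj hlt]
    exact mem_box_inf.2 fun s hs => mem_box_inf.1 hn s (Finset.mem_of_mem_erase hs)
  · rintro ⟨x, rfl⟩
    exact boxCoboundary_boxCoboundary x

/-- On a singleton `{s}` the coboundary reads off the coefficients of `f` in the box of `s`; larger
sets have no face of size zero. -/
theorem boxCoboundary_boxAugmentation_eq_zero_iff {m k : ℕ} (β : Fin k → Fin m → ℕ∞)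
    (f : bergman m) : boxCoboundary β 0 (boxAugmentation β f) = 0 ↔
      ∀ n ∈ ⋃ s, box (β s), coeff n f = 0 := by
  constructor
  · intro h n hn
    obtain ⟨s, hs⟩ := Set.mem_iUnion.1 hn
    have h1 := boxCoeff_boxCoboundary (boxAugmentation β f) (n := n) (T := {s})
      (mem_box_inf.2 (by simpa using hs))
    rw [h, boxCoeff_zero, coboundary, Finset.sum_singleton, faceSign_eq_one (by simp), one_smul,
      Finset.erase_singleton, boxCoeff_boxAugmentation] at h1
    exact h1.symm
  · intro h
    refine boxSum_ext fun n T hn => ?_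
    rw [boxCoeff_boxCoboundary _ hn, boxCoeff_zero]
    refine Finset.sum_eq_zero fun t ht => ?_
    by_cases hT : T.erase t = ∅
    · rw [hT, boxCoeff_boxAugmentation,
        h n (Set.mem_iUnion.2 ⟨t, mem_box_inf.1 hn t ht⟩), smul_zero]
    · rw [boxCoeff_of_card_ne _ _ (by rwa [Ne, Finset.card_eq_zero]), smul_zero]

theorem exists_boxes {m : ℕ} (U : UpperSet (Fin m →₀ ℕ)) :
    ∃ (k : ℕ) (β : Fin k → Fin m → ℕ∞), ∀ n, n ∈ ⋃ s, box (β s) ↔ n ∉ U := by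
  obtain ⟨F, hF⟩ := isBoxUnion_compl_of_isUpperSet U.upper
  refine ⟨F.card, fun s => (F.equivFin.symm s).1, fun n => ?_⟩
  have h1 : n ∉ U ↔ n ∈ ⋃ b ∈ F, box b := by rw [← hF]; rfl
  rw [h1]
  simp only [Set.mem_iUnion, exists_prop]
  constructor
  · rintro ⟨s, hs⟩
    exact ⟨_, (F.equivFin.symm s).2, hs⟩
  · rintro ⟨b, hb, hn⟩
    exact ⟨F.equivFin ⟨b, hb⟩, by simpa using hn⟩

/-- Precomposing with a surjection leaves the range unchanged. -/
theorem exact_boxAugmentation {m k : ℕ} (β : Fin k → Fin m → ℕ∞) :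
    Function.Exact ((boxCoboundary β 0).comp (boxAugmentation β)) (boxCoboundary β 1) := by
  intro y
  rw [exact_boxCoboundary β 0 y, ContinuousLinearMap.coe_comp,
      (boxAugmentation_surjective β).range_comp]

theorem exact_idealClosure {m k : ℕ} {β : Fin k → Fin m → ℕ∞} {T : Set (Fin m →₀ ℕ)}
    (h : ∀ n, n ∈ ⋃ s, box (β s) ↔ n ∉ upperClosure T) :
    Function.Exact
      (idealClosure (Ideal.span ((fun n => MvPolynomial.monomial n (1 : ℂ)) '' T))).subtype
      ((boxCoboundary β 0).comp (boxAugmentation β)) := by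
  intro f
  rw [ContinuousLinearMap.comp_apply, boxCoboundary_boxAugmentation_eq_zero_iff]
  simp only [h]
  rw [← mem_idealClosure_iff, Submodule.coe_subtype, Subtype.range_coe, SetLike.mem_coe]

end BergmanBox

end

theorem theorem1p1 (m : ℕ) (I : Ideal (MvPolynomial (Fin m) ℂ))
    (hI : ∃ T : Set (Fin m →₀ ℕ),
      I = Ideal.span ((fun n => MvPolynomial.monomial n (1 : ℂ)) '' T)) :
    ∃ (k : ℕ) (β : Fin k → Fin m → ℕ∞)
      (Ψ₀ : BergmanBox.bergman m →L[MvPolynomial (Fin m) ℂ] BergmanBox.boxSum β 1)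
      (Ψ : ∀ q : ℕ, BergmanBox.boxSum β (q + 1) →L[MvPolynomial (Fin m) ℂ]
        BergmanBox.boxSum β (q + 2)),
      Function.Injective (BergmanBox.idealClosure I).subtype ∧
      Function.Exact (BergmanBox.idealClosure I).subtype Ψ₀ ∧
      Function.Exact Ψ₀ (Ψ 0) ∧
      (∀ q : ℕ, Function.Exact (Ψ q) (Ψ (q + 1))) ∧
      (∀ q : ℕ, k < q → Subsingleton (BergmanBox.boxSum β q)) := by
  obtain ⟨T, rfl⟩ := hI
  obtain ⟨k, β, hβ⟩ := BergmanBox.exists_boxes (upperClosure T)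
  -- `Ψ q` leaves `A_{q+1}`. Since `A_{k+1} = 0`, exactness at `A_k` makes the last map surjective;
  -- for `k = 0` already `A₁ = 0`, and the closure is the whole space.
  exact ⟨k, β, (BergmanBox.boxCoboundary β 0).comp (BergmanBox.boxAugmentation β),
    fun q => BergmanBox.boxCoboundary β (q + 1), Subtype.val_injective,
    BergmanBox.exact_idealClosure hβ, BergmanBox.exact_boxAugmentation β,
    fun q => BergmanBox.exact_boxCoboundary β (q + 1),
    fun q hq => BergmanBox.boxSum_subsingleton β hq⟩
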